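/- \textbf{Model.} A consumer lives for $T<\infty$ periods. Her private type $\theta_t\in\{l,h\}$ follows a Markov chain with transition probabilities $\pi_{ij}=\mathbb P(\theta_{t+1}=j\mid\theta_t=i)$ satisfying $\pi_{ii}>\pi_{ji}$ for $i\ne j$, and with initial distribution $(\pi_l,\pi_h)$, $\pi_l,\pi_h>0$. In each period income $y_t$ is drawn from a finite set $Y\subset\mathbb R_+$ with distribution $p_{\theta_t}$; given $\theta_t$, it is independent of past incomes and of the future types. We assume $p_h(y)>0$ for all $y$ and $\sum_y p_l(y)y<\sum_y p_h(y)y$. A finite signal set $\Phi$ and a surjection $\phi:Y\to\Phi$ are given, with $p_i(\phi_0)=\sum_{y:\phi(y)=\phi_0}p_i(y)$. The utility $u:\mathbb R_+\to\mathbb R$ is $C^2$, strictly concave and strictly increasing, and $\delta\in(0,1)$ is the common discount factor. For a flow contract $z\in\mathbb R_+^Y$ let $v(z,i)=\sum_y p_i(y)u(z(y))$ and $\xi(z,i)=\sum_y p_i(y)(y-z(y))$. A direct mechanism $M=\{z_t\}_{t=1}^T$ assigns a flow contract $z_t(\theta^{t-1},\phi^{t-1},\theta_t)$ to the past reports $\theta^{t-1}$,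 the past signals $\phi^{t-1}$ and the current report $\theta_t$. It is incentive compatible if truth-telling maximizes the consumer's ex ante expected discounted utility over all reporting strategies, where a report may depend on all past incomes, types and reports and on the current type. Given $V=(V_l,V_h)$ with $V_h\ge V_l$, a mechanism is optimal if it maximizes the expected discounted profit $\mathbb E\sum_{t=1}^T\delta^{t-1}\xi(z_t,\theta_t)$ under truth-telling among all incentive compatible mechanisms that give expected discounted utility $V_\theta$ to each initial type $\theta\in\{l,h\}$. \textbf{Auxiliary problem.} Let $A$ be the set of $(\nu,\Delta)\in\mathbb R^2$ for which some $z\in\mathbb R_+^Y$ satisfies $v(z,h)=\nu$ and $v(z,l)=\nu-\Delta$, and for $(\nu,\Delta)\in A$ let $\chi(\nu,\Delta)$ be the infimum of $\sum_y p_h(y)z(y)$ over these $z$. Write $\chi_\nu=\partial\chi/\partial\nu$ and $\chi_\Delta=\partial\chi/\partial\Delta$. \textbf{Proposition.} Let $M$ be an optimal mechanism, and let $h^{t}=(h,\dots,h)$. Define $$\nu_t(\phi^{t-1})=v(z_t(h^{t-1},\phi^{t-1},h),h),\qquad \Delta_t(\phi^{t-1})=\nu_t(\phi^{t-1})-v(z_t(h^{t-1},\phi^{t-1},h),l),$$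 and let $\nu^l_t(\phi^{t-1})=v(z_t(h^{t-1},\phi^{t-1},l),l)$ be the flow utility at a first low-type report in period $t$. Let $1\le t\le T-1$ and $\phi^{t-1}\in\Phi^{t-1}$ be such that $(\nu_t,\Delta_t)(\phi^{t-1})\in\operatorname{int}A$ and $(\nu_{t+1},\Delta_{t+1})(\phi^{t-1},\phi)\in\operatorname{int}A$ for all $\phi\in\Phi$. Then $\chi$ is differentiable at $(\nu_t,\Delta_t)(\phi^{t-1})$, at each $(\nu_{t+1},\Delta_{t+1})(\phi^{t-1},\phi)$ and, if $\pi_{hl}>0$, at each $(\nu^l_{t+1}(\phi^{t-1},\phi),0)$. Moreover, omitting the argument $\phi^{t-1}$, $$\chi_\nu(\nu_t,\Delta_t)=\sum_{\phi\in\Phi}p_h(\phi)\Big\{\pi_{hh}\,\chi_\nu\big(\nu_{t+1}(\phi),\Delta_{t+1}(\phi)\big)+\pi_{hl}\,\chi_\nu\big(\nu^l_{t+1}(\phi),0\big)\Big\},$$ $$\chi_\Delta(\nu_t,\Delta_t)=\sum_{\phi\in\Phi}p_h(\phi)\frac{\pi_{hh}}{\pi_{hh}-\pi_{lh}}\Big\{\chi_\Delta\big(\nu_{t+1}(\phi),\Delta_{t+1}(\phi)\big)+\pi_{hl}\Big[\chi_\nu\big(\nu_{t+1}(\phi),\Delta_{t+1}(\phi)\big)-\chi_\nu\big(\nu^l_{t+1}(\phi),0\big)\Big]\Big\}.$$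 If $\pi_{hl}=0$, the terms multiplied by $\pi_{hl}$ are read as $0$. -/

import Mathlib

open scoped NNReal

/-- The two risk types of the consumer: low and high. -/
inductive RiskType
  | l
  | h
  deriving DecidableEq

open RiskType

instance : Fintype RiskType := ⟨{l, h}, fun x => by cases x <;> simp⟩

/-- Primitives of the dynamic insurance model with a finite horizon and an arbitrary
signal structure with set of signals `Φ`. -/
structure InsuranceModel (Φ : Type*) where
  /-- number of periods -/
  T : ℕ
  /-- finite set of income levels -/
  Y : Finset ℝ≥0
  /-- income distribution of each type -/
  p : RiskType → Y → ℝ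
  p_nonneg : ∀ i y, 0 ≤ p i y
  p_sum : ∀ i, ∑ y, p i y = 1
  /-- likelihood ratios `p l y / p h y` are well defined -/
  p_h_pos : ∀ y, 0 < p h y
  mean_lt : ∑ y : Y, p l y * ((y : ℝ≥0) : ℝ) < ∑ y : Y, p h y * ((y : ℝ≥0) : ℝ)
  /-- `trans i j` is the probability of type `j` next period given type `i` today -/
  trans : RiskType → RiskType → ℝ
  trans_nonneg : ∀ i j, 0 ≤ trans i j
  trans_sum : ∀ i, ∑ j, trans i j = 1
  /-- types are persistent -/
  persistent : ∀ i j, i ≠ j → trans j i < trans i i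
  /-- distribution of the initial type -/
  init : RiskType → ℝ
  init_pos : ∀ i, 0 < init i
  init_sum : ∑ i, init i = 1
  /-- Bernoulli utility; only its values on `[0, ∞)` are relevant -/
  u : ℝ → ℝ
  u_contDiff : ContDiffOn ℝ 2 u (Set.Ici 0)
  u_strictConcave : StrictConcaveOn ℝ (Set.Ici 0) u
  u_strictMono : StrictMonoOn u (Set.Ici 0)
  /-- discount factor -/
  δ : ℝ
  δ_pos : 0 < δ
  δ_lt_one : δ < 1
  /-- signal function -/
  signal : Y → Φ
  signal_surjective : Function.Surjective signal

namespace InsuranceModel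

variable {Φ : Type*} (E : InsuranceModel Φ)

/-- Flow contracts: nonnegative consumption for each income level. -/
abbrev FlowContract : Type := E.Y → ℝ≥0

/-- Expected flow utility of type `i` from the flow contract `z`. -/
noncomputable def v (z : E.FlowContract) (i : RiskType) : ℝ :=
  ∑ y, E.p i y * E.u (z y)

/-- Expected flow profit from type `i` under the flow contract `z`. -/
noncomputable def ξ (z : E.FlowContract) (i : RiskType) : ℝ :=
  ∑ y : E.Y, E.p i y * (((y : ℝ≥0) : ℝ) - (z y : ℝ))

open Classical in
/-- Probability of the signal `φ` for type `i`. -/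
noncomputable def pSig (i : RiskType) (φ : Φ) : ℝ :=
  ∑ y, if E.signal y = φ then E.p i y else 0

/-- Direct mechanisms. The flow contract offered in period `t` depends on the observable history,
the list of the past `t - 1` pairs (signal, report) with the MOST RECENT period first, and on the
current report. Only histories of length less than `T` matter. -/
abbrev Mechanism : Type _ := List (Φ × RiskType) → RiskType → E.FlowContract

/-- Private histories: past triples (income, report, true type), most recent period first. -/
abbrev PrivateHistory : Type := List (E.Y × RiskType × RiskType)

/-- The observable part (signals and reports) of a private history. -/
def observable (k : E.PrivateHistory) : List (Φ × RiskType) :=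
  k.map fun x => (E.signal x.1, x.2.1)

/-- Reporting strategies: the report as a function of private history and current type. -/
abbrev Strategy : Type := E.PrivateHistory → RiskType → RiskType

/-- The truth-telling strategy. -/
def truthful : E.Strategy := fun _ θ => θ

/-- Expected discounted utility over the remaining `n` periods of a consumer with private history
`k` and current type `θ` who follows the reporting strategy `r`. Given the current type, current
income and next period's type are independent. -/
noncomputable def contUtility (M : E.Mechanism) (r : E.Strategy) :
    ℕ → E.PrivateHistory → RiskType → ℝ
  | 0, _, _ => 0
  | n + 1, k, θ =>
      E.v (M (E.observable k) (r k θ)) θ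
        + E.δ * ∑ y, E.p θ y *
            ∑ θ', E.trans θ θ' * contUtility M r n ((y, r k θ, θ) :: k) θ'

/-- Ex ante expected discounted utility from the reporting strategy `r`. -/
noncomputable def exAnteUtility (M : E.Mechanism) (r : E.Strategy) : ℝ :=
  ∑ θ, E.init θ * E.contUtility M r E.T [] θ

/-- Expected discounted utility of an initial type `θ` under truth-telling. -/
noncomputable def initialUtility (M : E.Mechanism) (θ : RiskType) : ℝ :=
  E.contUtility M E.truthful E.T [] θ

/-- Incentive compatibility: truth-telling is at least as good as any reporting strategy. -/
def IncentiveCompatible (M : E.Mechanism) : Prop :=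
  ∀ r : E.Strategy, E.exAnteUtility M r ≤ E.exAnteUtility M E.truthful

/-- Expected discounted profit over the remaining `n` periods, under truth-telling, after the
observable history `η` and given the current type `θ`. -/
noncomputable def contProfit (M : E.Mechanism) :
    ℕ → List (Φ × RiskType) → RiskType → ℝ
  | 0, _, _ => 0
  | n + 1, η, θ =>
      E.ξ (M η θ) θ
        + E.δ * ∑ y, E.p θ y *
            ∑ θ', E.trans θ θ' * contProfit M n ((E.signal y, θ) :: η) θ'

/-- Expected discounted profit of a mechanism. -/
noncomputable def profit (M : E.Mechanism) : ℝ :=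
  ∑ θ, E.init θ * E.contProfit M E.T [] θ

/-- Feasibility: `M` is incentive compatible and delivers utility `V θ` to each initial type. -/
def Feasible (V : RiskType → ℝ) (M : E.Mechanism) : Prop :=
  E.IncentiveCompatible M ∧ ∀ θ, E.initialUtility M θ = V θ

/-- `M` solves the firm's profit maximization problem with utility levels `V`. -/
def IsOptimal (V : RiskType → ℝ) (M : E.Mechanism) : Prop :=
  E.Feasible V M ∧ ∀ M' : E.Mechanism, E.Feasible V M' → E.profit M' ≤ E.profit M

/-- The flow contract `z` satisfies the promise-keeping and threat-keeping constraints. -/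
def Delivers (z : E.FlowContract) (ν Δ : ℝ) : Prop :=
  E.v z h = ν ∧ E.v z l = ν - Δ

/-- The pairs `(ν, Δ)` for which the auxiliary problem has a feasible flow contract. -/
def A : Set (ℝ × ℝ) := {q | ∃ z : E.FlowContract, E.Delivers z q.1 q.2}

/-- Cost function of the auxiliary static cost minimization problem. -/
noncomputable def χ (ν Δ : ℝ) : ℝ :=
  sInf {c : ℝ | ∃ z : E.FlowContract, E.Delivers z ν Δ ∧ c = ∑ y, E.p h y * (z y : ℝ)}

/-- Marginal cost of flow utility. -/
noncomputable def χν (ν Δ : ℝ) : ℝ := deriv (fun x => E.χ x Δ) ν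

/-- Marginal cost of distortion. -/
noncomputable def χΔ (ν Δ : ℝ) : ℝ := deriv (fun x => E.χ ν x) Δ

/-- Differentiability of the auxiliary cost as a function of two variables. -/
def χDifferentiableAt (ν Δ : ℝ) : Prop :=
  DifferentiableAt ℝ (fun q : ℝ × ℝ => E.χ q.1 q.2) (ν, Δ)

/-- The observable history with signals `s` and only high-type reports. -/
def highHistory (s : List Φ) : List (Φ × RiskType) := s.map fun φ => (φ, h)

/-- Flow utility `ν_t(φ^{t-1})` of the high type after signals `s = φ^{t-1}` (most recent first)
and high-type reports only, where `t = s.length + 1`. -/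
noncomputable def flowUtility (M : E.Mechanism) (s : List Φ) : ℝ :=
  E.v (M (highHistory s) h) h

/-- Distortion `Δ_t(φ^{t-1})`. -/
noncomputable def distortion (M : E.Mechanism) (s : List Φ) : ℝ :=
  E.flowUtility M s - E.v (M (highHistory s) h) l

/-- Flow utility `ν^l_t(φ^{t-1})` of the consumer in period `t` if her first low-type report is
made in that period. When the contract is the constant consumption `c`, this is `u c`. -/
noncomputable def lowFlowUtility (M : E.Mechanism) (s : List Φ) : ℝ :=
  E.v (M (highHistory s) l) l

end InsuranceModel

namespace InsuranceModel

variable {Φ : Type*} (E : InsuranceModel Φ)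

/-! The two equations are first-order conditions of a cost minimization; the work is to show that
enough local variations of an optimal mechanism are admissible and that the cost is differentiable
along them.

Admissibility. The problem is relaxed to plans: contracts after all-high histories, and constant
consumption forever after the first low report. The only constraint kept is that a low type with an
all-high history does not gain from reporting high once more. The neglected constraint, that a high
type does not imitate a low one, is restored by pooling both types from the first signal history
where it fails. Pooling at the certainty equivalent is neutral for a previous high type, saves cost
by Jensen, and by persistence makes mimicking less attractive. Hence an optimal `M` costs no more
than any relaxed plan with the same initial utilities (`Plan.total_cost_le_of_isOptimal`).
Conversely `M` induces such a plan at no extra cost: each low continuation is replaced by the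
certainty equivalent of the best one (`exists_lowEquiv`).

Variation. After the signals `s`, raise next period's high flow utility by `a`, its distortion by
`b`, and the low type's lifetime utility by `a - b`; today's contract offsets the effect on the true
high type and on the mimicking low type. Every constraint keeps its slack, so cost cannot fall
(`Perturbation.cost_le`). With `a = b = 0` this shows that the contracts of `M` attain `χ` and that
a low type reached with positive probability gets the certainty equivalent as flow utility.
Differentiating at zero gives `Setting.first_order`; direction (1, 0) is the first equation, and
direction (0, 1) combined with the first is the second.

Differentiability. At an interior point an optimal contract has positive consumption at two incomes
with different likelihood ratios. Adjusting only these two gives a smooth upper bound that touches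
the midpoint convex `χ`, which forces differentiability. -/

theorem sum_riskType (f : RiskType → ℝ) : ∑ θ, f θ = f l + f h := by
  change ∑ θ ∈ ({l, h} : Finset RiskType), f θ = _
  rw [Finset.sum_pair (by decide)]

theorem trans_add (i : RiskType) : E.trans i l + E.trans i h = 1 := by
  rw [← sum_riskType]; exact E.trans_sum i

theorem trans_h_h_pos : 0 < E.trans h h :=
  (E.trans_nonneg l h).trans_lt (E.persistent h l (by decide))

/-! ### Dynamic programming and incentive compatibility -/

/-- Expectation of next period's value `W` given type `θ` and report `r`. -/
noncomputable def next (W : List (Φ × RiskType) → RiskType → ℝ) (η : List (Φ × RiskType))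
    (θ r : RiskType) : ℝ :=
  ∑ y, E.p θ y * ∑ θ', E.trans θ θ' * W ((E.signal y, r) :: η) θ'

theorem next_mono {W W' : List (Φ × RiskType) → RiskType → ℝ} {η : List (Φ × RiskType)}
    {θ r : RiskType} (hW : ∀ φ θ', W ((φ, r) :: η) θ' ≤ W' ((φ, r) :: η) θ') :
    E.next W η θ r ≤ E.next W' η θ r :=
  Finset.sum_le_sum fun _ _ => mul_le_mul_of_nonneg_left
    (Finset.sum_le_sum fun _ _ => mul_le_mul_of_nonneg_left (hW _ _) (E.trans_nonneg _ _))
    (E.p_nonneg _ _)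

theorem next_const {W : List (Φ × RiskType) → RiskType → ℝ} {η : List (Φ × RiskType)}
    {θ r : RiskType} {c : ℝ} (hW : ∀ φ θ', W ((φ, r) :: η) θ' = c) :
    E.next W η θ r = c := by
  simp only [next, hW, ← Finset.sum_mul, E.trans_sum, E.p_sum, one_mul]

/-- Expected discounted sum of the flow payoff `f` over `n` periods under truth-telling. -/
noncomputable def total (f : List (Φ × RiskType) → RiskType → ℝ) :
    ℕ → List (Φ × RiskType) → RiskType → ℝ
  | 0, _, _ => 0
  | n + 1, η, θ => f η θ + E.δ * E.next (total f n) η θ θ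

/-- The value of the best reporting strategy over `n` periods. -/
noncomputable def best (M : E.Mechanism) : ℕ → List (Φ × RiskType) → RiskType → ℝ
  | 0, _, _ => 0
  | n + 1, η, θ =>
      max (E.v (M η h) θ + E.δ * E.next (best M n) η θ h)
        (E.v (M η l) θ + E.δ * E.next (best M n) η θ l)

/-- Flow utility of a truthful type `θ`. -/
noncomputable def flow (M : E.Mechanism) (η : List (Φ × RiskType)) (θ : RiskType) : ℝ :=
  E.v (M η θ) θ

/-- Expected consumption of type `i` under the flow contract `z`. -/
noncomputable def cost (z : E.FlowContract) (i : RiskType) : ℝ := ∑ y, E.p i y * (z y : ℝ)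

/-- Flow cost of a truthful type `θ`. -/
noncomputable def flowCost (M : E.Mechanism) (η : List (Φ × RiskType)) (θ : RiskType) : ℝ :=
  E.cost (M η θ) θ

theorem le_best_succ (M : E.Mechanism) (n : ℕ) (η : List (Φ × RiskType)) (θ r : RiskType) :
    E.v (M η r) θ + E.δ * E.next (E.best M n) η θ r ≤ E.best M (n + 1) η θ := by
  cases r
  · exact le_max_right _ _
  · exact le_max_left _ _

theorem total_le_best (M : E.Mechanism) (n : ℕ) :
    ∀ η θ, E.total (E.flow M) n η θ ≤ E.best M n η θ := by
  induction n with
  | zero => intros; exact le_rfl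
  | succ n ih =>
    intro η θ
    refine le_trans ?_ (E.le_best_succ M n η θ θ)
    exact add_le_add le_rfl (mul_le_mul_of_nonneg_left (E.next_mono fun _ _ => ih _ _) E.δ_pos.le)

theorem contUtility_succ (M : E.Mechanism) (r : E.Strategy) (n : ℕ) (k : E.PrivateHistory)
    (θ : RiskType) :
    E.contUtility M r (n + 1) k θ = E.v (M (E.observable k) (r k θ)) θ
        + E.δ * ∑ y, E.p θ y *
            ∑ θ', E.trans θ θ' * E.contUtility M r n ((y, r k θ, θ) :: k) θ' := rfl

theorem contUtility_truthful (M : E.Mechanism) (n : ℕ) :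
    ∀ k θ, E.contUtility M E.truthful n k θ = E.total (E.flow M) n (E.observable k) θ := by
  induction n with
  | zero => intros; rfl
  | succ n ih => intro k θ; simp only [contUtility_succ, ih]; rfl

theorem contUtility_le_best (M : E.Mechanism) (r : E.Strategy) (n : ℕ) :
    ∀ k θ, E.contUtility M r n k θ ≤ E.best M n (E.observable k) θ := by
  induction n with
  | zero => intros; exact le_rfl
  | succ n ih =>
    intro k θ
    refine le_trans ?_ (E.le_best_succ M n _ θ (r k θ))
    rw [contUtility_succ]
    refine add_le_add le_rfl (mul_le_mul_of_nonneg_left ?_ E.δ_pos.le)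
    exact Finset.sum_le_sum fun y _ => mul_le_mul_of_nonneg_left
      (Finset.sum_le_sum fun θ' _ => mul_le_mul_of_nonneg_left (ih _ _) (E.trans_nonneg _ _))
      (E.p_nonneg _ _)

/-- A strategy sees only the history, but its length fixes the number of remaining periods, so the
maximizer for the right horizon can be selected. Earlier true types do not matter because types are
Markov. -/
theorem exists_contUtility_eq_best (M : E.Mechanism) :
    ∃ r : E.Strategy, ∀ n k θ, n + k.length = E.T →
      E.contUtility M r n k θ = E.best M n (E.observable k) θ := by
  have hr : ∀ (k : E.PrivateHistory) (θ : RiskType), ∃ r : RiskType, ∀ n, n + 1 + k.length = E.T →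
      E.v (M (E.observable k) r) θ + E.δ * E.next (E.best M n) (E.observable k) θ r
        = E.best M (n + 1) (E.observable k) θ := by
    intro k θ
    have hn : ∀ n, n + 1 + k.length = E.T → n = E.T - k.length - 1 := fun n hn => by omega
    rcases max_choice
      (E.v (M (E.observable k) h) θ
        + E.δ * E.next (E.best M (E.T - k.length - 1)) (E.observable k) θ h)
      (E.v (M (E.observable k) l) θ
        + E.δ * E.next (E.best M (E.T - k.length - 1)) (E.observable k) θ l) with hm | hm
    · refine ⟨h, fun n hn' => ?_⟩
      rw [hn n hn']; exact hm.symm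
    · refine ⟨l, fun n hn' => ?_⟩
      rw [hn n hn']; exact hm.symm
  choose r hr using hr
  refine ⟨r, fun n => ?_⟩
  induction n with
  | zero => intros; rfl
  | succ n ih =>
    intro k θ hk
    rw [← hr k θ n hk, contUtility_succ]
    congr 2
    refine Finset.sum_congr rfl fun y _ => ?_
    congr 1
    refine Finset.sum_congr rfl fun θ' _ => ?_
    rw [ih _ _ (by simp only [List.length_cons]; omega)]
    rfl

/-- Both initial types have positive probability, so equality of the averages of `total ≤ best`
forces equality for each type. -/
theorem incentiveCompatible_iff (M : E.Mechanism) :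
    E.IncentiveCompatible M ↔ ∀ θ, E.best M E.T [] θ = E.total (E.flow M) E.T [] θ := by
  constructor
  · intro hM
    obtain ⟨r, hr⟩ := E.exists_contUtility_eq_best M
    have h1 := hM r
    simp only [exAnteUtility, contUtility_truthful] at h1
    rw [Finset.sum_congr rfl fun θ _ => by rw [hr E.T [] θ (by simp)]] at h1
    have h2 : ∀ θ ∈ Finset.univ, E.init θ * E.total (E.flow M) E.T [] θ
        ≤ E.init θ * E.best M E.T [] θ := fun θ _ =>
      mul_le_mul_of_nonneg_left (E.total_le_best M _ _ _) (E.init_pos θ).le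
    have h3 := (Finset.sum_eq_sum_iff_of_le h2).1 (le_antisymm (Finset.sum_le_sum h2) h1)
    exact fun θ => (mul_left_cancel₀ (E.init_pos θ).ne' (h3 θ (Finset.mem_univ _))).symm
  · intro hM r
    refine Finset.sum_le_sum fun θ _ => mul_le_mul_of_nonneg_left ?_ (E.init_pos θ).le
    rw [contUtility_truthful]
    exact (E.contUtility_le_best M r _ _ _).trans_eq (hM θ)

/-- Truth-telling that is optimal now stays optimal at each successor of positive probability: a
weighted sum of the inequalities `total ≤ best` is tight, hence so is every term of positive weight.
-/
theorem best_eq_total_of_succ {M : E.Mechanism} {n : ℕ} {η : List (Φ × RiskType)} {θ : RiskType}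
    (hb : E.best M (n + 1) η θ = E.total (E.flow M) (n + 1) η θ) {y : E.Y} {θ' : RiskType}
    (hy : 0 < E.p θ y) (hθ : 0 < E.trans θ θ') :
    E.best M n ((E.signal y, θ) :: η) θ' = E.total (E.flow M) n ((E.signal y, θ) :: η) θ' := by
  have h1 : E.v (M η θ) θ + E.δ * E.next (E.best M n) η θ θ
      ≤ E.v (M η θ) θ + E.δ * E.next (E.total (E.flow M) n) η θ θ :=
    (E.le_best_succ M n η θ θ).trans_eq hb
  have h2 : E.next (E.best M n) η θ θ ≤ E.next (E.total (E.flow M) n) η θ θ :=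
    le_of_mul_le_mul_left (by linarith) E.δ_pos
  have h3 : ∀ (y : E.Y) (θ' : RiskType),
      E.trans θ θ' * E.total (E.flow M) n ((E.signal y, θ) :: η) θ'
        ≤ E.trans θ θ' * E.best M n ((E.signal y, θ) :: η) θ' := fun y θ' =>
    mul_le_mul_of_nonneg_left (E.total_le_best M _ _ _) (E.trans_nonneg _ _)
  have h4 : ∀ y ∈ Finset.univ,
      E.p θ y * ∑ θ', E.trans θ θ' * E.total (E.flow M) n ((E.signal y, θ) :: η) θ'
        ≤ E.p θ y * ∑ θ', E.trans θ θ' * E.best M n ((E.signal y, θ) :: η) θ' := fun y _ =>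
    mul_le_mul_of_nonneg_left (Finset.sum_le_sum fun θ' _ => h3 y θ') (E.p_nonneg _ _)
  have h5 := (Finset.sum_eq_sum_iff_of_le h4).1 (le_antisymm (Finset.sum_le_sum h4) h2) y
    (Finset.mem_univ _)
  have h6 := (Finset.sum_eq_sum_iff_of_le fun θ' _ => h3 y θ').1 (mul_left_cancel₀ hy.ne' h5) θ'
    (Finset.mem_univ _)
  exact (mul_left_cancel₀ hθ.ne' h6).symm

theorem highHistory_cons (φ : Φ) (s : List Φ) :
    highHistory (φ :: s) = (φ, h) :: highHistory s := rfl

theorem best_high {M : E.Mechanism} (hM : E.IncentiveCompatible M) (s : List Φ) :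
    ∀ n, n + s.length = E.T →
      E.best M n (highHistory s) h = E.total (E.flow M) n (highHistory s) h := by
  induction s with
  | nil => intro n hn; simp only [List.length_nil, add_zero] at hn; subst hn
           exact (E.incentiveCompatible_iff M).1 hM h
  | cons φ s ih =>
    intro n hn
    obtain ⟨y, rfl⟩ := E.signal_surjective φ
    exact E.best_eq_total_of_succ (ih (n + 1) (by simp only [List.length_cons] at hn; omega))
      (E.p_h_pos y) E.trans_h_h_pos

/-- The factor covers the case where a low type never follows a high one; truthful optimality may
then fail at this unreached history. -/
theorem trans_mul_best_low {M : E.Mechanism} (hM : E.IncentiveCompatible M) (s : List Φ) (φ : Φ)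
    (n : ℕ) (hn : n + 1 + s.length = E.T) :
    E.trans h l * E.total (E.flow M) n (highHistory (φ :: s)) l
      = E.trans h l * E.best M n (highHistory (φ :: s)) l := by
  obtain h0 | h0 := (E.trans_nonneg h l).eq_or_lt
  · rw [← h0]; simp
  · obtain ⟨y, rfl⟩ := E.signal_surjective φ
    rw [highHistory_cons, E.best_eq_total_of_succ (E.best_high hM s (n + 1) hn) (E.p_h_pos y) h0]

theorem total_sub (f g : List (Φ × RiskType) → RiskType → ℝ) (n : ℕ) :
    ∀ η θ, E.total (fun η θ => f η θ - g η θ) n η θ = E.total f n η θ - E.total g n η θ := by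
  induction n with
  | zero => intros; simp [total]
  | succ n ih =>
    intro η θ
    simp only [total, next, ih, mul_sub, Finset.sum_sub_distrib]
    ring

theorem contProfit_eq (M : E.Mechanism) (n : ℕ) : ∀ η θ, E.contProfit M n η θ
    = E.total (fun η θ => E.ξ (M η θ) θ) n η θ := by
  induction n with
  | zero => intros; rfl
  | succ n ih => intro η θ; simp only [contProfit, ih, total, next]

/-- Expected income does not depend on the mechanism, so maximizing profit is minimizing cost. -/
theorem profit_eq (M : E.Mechanism) : E.profit M
    = (∑ θ, E.init θ * E.total (fun _ θ => ∑ y : E.Y, E.p θ y * ((y : ℝ≥0) : ℝ)) E.T [] θ)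
      - ∑ θ, E.init θ * E.total (E.flowCost M) E.T [] θ := by
  rw [profit, ← Finset.sum_sub_distrib]
  refine Finset.sum_congr rfl fun θ _ => ?_
  rw [← mul_sub, ← total_sub, contProfit_eq]
  congr 2
  funext η θ
  simp only [ξ, flowCost, cost, mul_sub, Finset.sum_sub_distrib]

/-! ### Jensen's inequality over incomes, types and time -/

/-- Present value of a unit payment in each of `n` periods. -/
noncomputable def annuity : ℕ → ℝ
  | 0 => 0
  | n + 1 => 1 + E.δ * annuity n

theorem annuity_nonneg (n : ℕ) : 0 ≤ E.annuity n := by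
  induction n with
  | zero => exact le_rfl
  | succ n ih => exact add_nonneg zero_le_one (mul_nonneg E.δ_pos.le ih)

theorem annuity_pos {n : ℕ} (hn : n ≠ 0) : 0 < E.annuity n := by
  obtain ⟨n, rfl⟩ := Nat.exists_eq_succ_of_ne_zero hn
  exact add_pos_of_pos_of_nonneg one_pos (mul_nonneg E.δ_pos.le (E.annuity_nonneg n))

theorem u_lt_iff {a b : ℝ} (ha : 0 ≤ a) (hb : 0 ≤ b) : E.u a < E.u b ↔ a < b :=
  E.u_strictMono.lt_iff_lt ha hb

theorem u_le_iff {a b : ℝ} (ha : 0 ≤ a) (hb : 0 ≤ b) : E.u a ≤ E.u b ↔ a ≤ b :=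
  E.u_strictMono.le_iff_le ha hb

theorem u_zero_le {a : ℝ} (ha : 0 ≤ a) : E.u 0 ≤ E.u a := (E.u_le_iff le_rfl ha).2 ha

theorem u_concave {a b s t : ℝ} (ha : 0 ≤ a) (hb : 0 ≤ b) (hs : 0 ≤ s) (ht : 0 ≤ t)
    (hst : s + t = 1) : s * E.u a + t * E.u b ≤ E.u (s * a + t * b) :=
  E.u_strictConcave.concaveOn.2 ha hb hs ht hst

theorem exists_u_eq {x k : ℝ} (hk : 0 ≤ k) (h0 : E.u 0 ≤ x) (hx : x ≤ E.u k) :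
    ∃ c : ℝ≥0, E.u c = x ∧ (c : ℝ) ≤ k := by
  obtain ⟨c, hc, rfl⟩ := intermediate_value_Icc hk
    (E.u_contDiff.continuousOn.mono Set.Icc_subset_Ici_self) ⟨h0, hx⟩
  exact ⟨⟨c, hc.1⟩, rfl, hc.2⟩

theorem cost_nonneg (z : E.FlowContract) (i : RiskType) : 0 ≤ E.cost z i :=
  Finset.sum_nonneg fun y _ => mul_nonneg (E.p_nonneg _ _) (z y).2

theorem v_le_u_cost (z : E.FlowContract) (i : RiskType) : E.v z i ≤ E.u (E.cost z i) :=
  E.u_strictConcave.concaveOn.le_map_sum (fun y _ => E.p_nonneg i y) (E.p_sum i)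
    fun y _ => (z y).2

theorem u_zero_le_v (z : E.FlowContract) (i : RiskType) : E.u 0 ≤ E.v z i := by
  rw [← one_mul (E.u 0), ← E.p_sum i, Finset.sum_mul]
  exact Finset.sum_le_sum fun y _ => mul_le_mul_of_nonneg_left (E.u_zero_le (z y).2)
    (E.p_nonneg _ _)

/-- Full insurance at consumption level `c`. -/
def const (c : ℝ≥0) : E.FlowContract := fun _ => c

theorem v_const (c : ℝ≥0) (i : RiskType) : E.v (E.const c) i = E.u c := by
  simp only [v, const, ← Finset.sum_mul, E.p_sum, one_mul]

theorem cost_const (c : ℝ≥0) (i : RiskType) : E.cost (E.const c) i = c := by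
  simp only [cost, const, ← Finset.sum_mul, E.p_sum, one_mul]

theorem next_nonneg {W : List (Φ × RiskType) → RiskType → ℝ} {η : List (Φ × RiskType)}
    {θ r : RiskType} (hW : ∀ φ θ', 0 ≤ W ((φ, r) :: η) θ') : 0 ≤ E.next W η θ r :=
  Finset.sum_nonneg fun _ _ => mul_nonneg (E.p_nonneg _ _)
    (Finset.sum_nonneg fun _ _ => mul_nonneg (E.trans_nonneg _ _) (hW _ _))

theorem total_cost_nonneg (M : E.Mechanism) (n : ℕ) :
    ∀ η θ, 0 ≤ E.total (E.flowCost M) n η θ := by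
  induction n with
  | zero => intros; exact le_rfl
  | succ n ih =>
    intro η θ
    exact add_nonneg (E.cost_nonneg _ _)
      (mul_nonneg E.δ_pos.le (E.next_nonneg fun _ _ => ih _ _))

/-- Concavity of `u` with the discounted weights of today and of the remaining periods, normalized
to sum to one. -/
theorem annuity_mul_concave (n : ℕ) {a x : ℝ} (ha : 0 ≤ a) (hx : 0 ≤ x) :
    E.u a + E.δ * (E.annuity n * E.u x)
      ≤ E.annuity (n + 1) * E.u ((a + E.δ * (E.annuity n * x)) / E.annuity (n + 1)) := by
  have hp := E.annuity_pos n.succ_ne_zero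
  have h1 : 1 / E.annuity (n + 1) + E.δ * E.annuity n / E.annuity (n + 1) = 1 := by
    rw [← add_div]; exact div_self hp.ne'
  have h2 := E.u_concave ha hx (one_div_nonneg.2 hp.le)
    (div_nonneg (mul_nonneg E.δ_pos.le (E.annuity_nonneg n)) hp.le) h1
  have h3 : 1 / E.annuity (n + 1) * a + E.δ * E.annuity n / E.annuity (n + 1) * x
      = (a + E.δ * (E.annuity n * x)) / E.annuity (n + 1) := by ring
  rw [h3] at h2
  calc _ = E.annuity (n + 1) * (1 / E.annuity (n + 1) * E.u a
        + E.δ * E.annuity n / E.annuity (n + 1) * E.u x) := by field_simp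
    _ ≤ _ := mul_le_mul_of_nonneg_left h2 hp.le

/-- Jensen's inequality for next period's values. -/
theorem next_le_u {W C : List (Φ × RiskType) → RiskType → ℝ} {η : List (Φ × RiskType)}
    {θ r : RiskType} {a : ℝ} (ha : 0 ≤ a) (hC : ∀ φ θ', 0 ≤ C ((φ, r) :: η) θ')
    (hW : ∀ φ θ', W ((φ, r) :: η) θ' ≤ a * E.u (C ((φ, r) :: η) θ' / a)) :
    E.next W η θ r ≤ a * E.u (E.next C η θ r / a) := by
  have h1 : ∑ θ', E.trans θ θ' = 1 := E.trans_sum θ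
  have hdiv : ∀ φ θ', 0 ≤ C ((φ, r) :: η) θ' / a := fun _ _ => div_nonneg (hC _ _) ha
  have hin : ∀ y, ∑ θ', E.trans θ θ' * E.u (C ((E.signal y, r) :: η) θ' / a)
      ≤ E.u (∑ θ', E.trans θ θ' * (C ((E.signal y, r) :: η) θ' / a)) := fun y =>
    E.u_strictConcave.concaveOn.le_map_sum (fun θ' _ => E.trans_nonneg θ θ') h1
      fun θ' _ => hdiv _ _
  have hout := E.u_strictConcave.concaveOn.le_map_sum (t := Finset.univ) (w := E.p θ)
    (p := fun y => ∑ θ', E.trans θ θ' * (C ((E.signal y, r) :: η) θ' / a))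
    (fun y _ => E.p_nonneg θ y) (E.p_sum θ)
    fun y _ => Finset.sum_nonneg fun θ' _ => mul_nonneg (E.trans_nonneg _ _) (hdiv _ _)
  have heq : ∑ y, E.p θ y • ∑ θ', E.trans θ θ' * (C ((E.signal y, r) :: η) θ' / a)
      = E.next C η θ r / a := by
    simp only [next, Finset.sum_div, smul_eq_mul, mul_div_assoc]
  rw [heq] at hout
  calc E.next W η θ r
      ≤ ∑ y, E.p θ y * ∑ θ', E.trans θ θ' * (a * E.u (C ((E.signal y, r) :: η) θ' / a)) :=
        Finset.sum_le_sum fun _ _ => mul_le_mul_of_nonneg_left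
          (Finset.sum_le_sum fun _ _ => mul_le_mul_of_nonneg_left (hW _ _) (E.trans_nonneg _ _))
          (E.p_nonneg _ _)
    _ = a * ∑ y, E.p θ y * ∑ θ', E.trans θ θ' * E.u (C ((E.signal y, r) :: η) θ' / a) := by
        simp only [Finset.mul_sum]
        refine Finset.sum_congr rfl fun _ _ => Finset.sum_congr rfl fun _ _ => by ring
    _ ≤ a * ∑ y, E.p θ y • E.u (∑ θ', E.trans θ θ' * (C ((E.signal y, r) :: η) θ' / a)) :=
        mul_le_mul_of_nonneg_left (Finset.sum_le_sum fun y _ =>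
          mul_le_mul_of_nonneg_left (hin y) (E.p_nonneg _ _)) ha
    _ ≤ _ := mul_le_mul_of_nonneg_left hout ha

/-- Jensen's inequality over time and states. -/
theorem total_flow_le (M : E.Mechanism) (n : ℕ) : ∀ η θ, E.total (E.flow M) n η θ
    ≤ E.annuity n * E.u (E.total (E.flowCost M) n η θ / E.annuity n) := by
  induction n with
  | zero => intros; simp [total, annuity]
  | succ n ih =>
    intro η θ
    have hnx := E.next_le_u (θ := θ) (E.annuity_nonneg n)
      (fun φ θ' => E.total_cost_nonneg M n ((φ, θ) :: η) θ') (fun φ θ' => ih _ _)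
    have hx : 0 ≤ E.next (E.total (E.flowCost M) n) η θ θ :=
      E.next_nonneg fun _ _ => E.total_cost_nonneg M n _ _
    have h1 : E.annuity n * (E.next (E.total (E.flowCost M) n) η θ θ / E.annuity n)
        = E.next (E.total (E.flowCost M) n) η θ θ := by
      rcases eq_or_ne n 0 with rfl | hn
      · simp [annuity, E.next_const (W := E.total (E.flowCost M) 0) (c := 0) fun _ _ => rfl]
      · rw [mul_div_cancel₀ _ (E.annuity_pos hn).ne']
    calc E.total (E.flow M) (n + 1) η θ
        ≤ E.u (E.cost (M η θ) θ) + E.δ * (E.annuity n *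
            E.u (E.next (E.total (E.flowCost M) n) η θ θ / E.annuity n)) :=
          add_le_add (E.v_le_u_cost _ _) (mul_le_mul_of_nonneg_left hnx E.δ_pos.le)
      _ ≤ _ := E.annuity_mul_concave n (E.cost_nonneg _ _) (div_nonneg hx (E.annuity_nonneg n))
      _ = _ := by rw [h1]; rfl

theorem annuity_mul_u_zero_le_total (M : E.Mechanism) (n : ℕ) :
    ∀ η θ, E.annuity n * E.u 0 ≤ E.total (E.flow M) n η θ := by
  induction n with
  | zero => intros; simp [total, annuity]
  | succ n ih =>
    intro η θ
    have h1 : E.annuity n * E.u 0 ≤ E.next (E.total (E.flow M) n) η θ θ := by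
      rw [← E.next_const (W := fun _ _ => E.annuity n * E.u 0) (η := η) (θ := θ) (r := θ)
        fun _ _ => rfl]
      exact E.next_mono fun _ _ => ih _ _
    have h2 := mul_le_mul_of_nonneg_left h1 E.δ_pos.le
    have h3 := E.u_zero_le_v (M η θ) θ
    simp only [annuity, total, flow]
    linarith

/-- `u` may be bounded, so the intermediate value argument for certainty equivalents needs an
attained upper bound. `total_flow_le` does not provide it: the best strategy need not be truthful.
-/
theorem exists_best_le (M : E.Mechanism) (n : ℕ) :
    ∀ η θ, ∃ k : ℝ, 0 ≤ k ∧ E.best M n η θ ≤ E.annuity n * E.u k := by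
  induction n with
  | zero => intro _ _; exact ⟨0, le_rfl, by simp [best, annuity]⟩
  | succ n ih =>
    intro η θ
    choose k hk hb using ih
    have hr : ∀ r, ∃ c : ℝ, 0 ≤ c ∧ E.v (M η r) θ + E.δ * E.next (E.best M n) η θ r
        ≤ E.annuity (n + 1) * E.u c := by
      intro r
      have h1 : E.next (E.best M n) η θ r ≤ _ := E.next_le_u (W := E.best M n)
        (C := fun η θ => E.annuity n * k η θ) (E.annuity_nonneg n)
        (fun _ _ => mul_nonneg (E.annuity_nonneg n) (hk _ _)) (fun φ θ' => by
          rcases eq_or_ne n 0 with rfl | hn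
          · simp [best, annuity]
          · rw [mul_div_cancel_left₀ _ (E.annuity_pos hn).ne']; exact hb _ _)
      have hx : 0 ≤ E.next (fun η θ => E.annuity n * k η θ) η θ r / E.annuity n :=
        div_nonneg (E.next_nonneg fun _ _ => mul_nonneg (E.annuity_nonneg n) (hk _ _))
          (E.annuity_nonneg n)
      refine ⟨_, ?_, (add_le_add (E.v_le_u_cost _ _)
        (mul_le_mul_of_nonneg_left h1 E.δ_pos.le)).trans
        (E.annuity_mul_concave n (E.cost_nonneg _ _) hx)⟩
      exact div_nonneg (add_nonneg (E.cost_nonneg _ _) (mul_nonneg E.δ_pos.le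
        (mul_nonneg (E.annuity_nonneg n) hx))) (E.annuity_nonneg _)
    choose c hc hcb using hr
    have hle : ∀ r, E.v (M η r) θ + E.δ * E.next (E.best M n) η θ r
        ≤ E.annuity (n + 1) * E.u (max (c h) (c l)) := fun r =>
      (hcb r).trans (mul_le_mul_of_nonneg_left ((E.u_le_iff (hc r)
        ((hc h).trans (le_max_left _ _))).2 (by cases r <;> simp)) (E.annuity_nonneg _))
    exact ⟨max (c h) (c l), (hc h).trans (le_max_left _ _), max_le (hle h) (hle l)⟩

/-! ### Plans and the mechanisms that carry them out -/

/-- Plans: flow contracts after high-type reports only, and a constant consumption level forever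
after the first low-type report. -/
structure Plan where
  high : List Φ → E.FlowContract
  low : List Φ → ℝ≥0

/-- Expected value for a type `i` of next period's value: `f` for a high type, `g` for a low
type. -/
noncomputable def branch (i : RiskType) (f g : List Φ → ℝ) (s : List Φ) : ℝ :=
  ∑ y, E.p i y * (E.trans i h * f (E.signal y :: s) + E.trans i l * g (E.signal y :: s))

theorem branch_mono {i : RiskType} {f g f' g' : List Φ → ℝ} {s : List Φ}
    (hfg : ∀ φ, E.trans i h * f (φ :: s) + E.trans i l * g (φ :: s)
      ≤ E.trans i h * f' (φ :: s) + E.trans i l * g' (φ :: s)) :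
    E.branch i f g s ≤ E.branch i f' g' s :=
  Finset.sum_le_sum fun _ _ => mul_le_mul_of_nonneg_left (hfg _) (E.p_nonneg _ _)

theorem branch_congr {i : RiskType} {f g f' g' : List Φ → ℝ} {s : List Φ}
    (hfg : ∀ φ, E.trans i h * f (φ :: s) + E.trans i l * g (φ :: s)
      = E.trans i h * f' (φ :: s) + E.trans i l * g' (φ :: s)) :
    E.branch i f g s = E.branch i f' g' s :=
  Finset.sum_congr rfl fun _ _ => by rw [hfg]

theorem branch_const {i : RiskType} {f g : List Φ → ℝ} {s : List Φ} {c : ℝ}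
    (hf : ∀ φ, f (φ :: s) = c) (hg : ∀ φ, g (φ :: s) = c) :
    E.branch i f g s = c := by
  have h1 : E.trans i h + E.trans i l = 1 := by rw [add_comm]; exact E.trans_add i
  simp only [branch, hf, hg, ← add_mul, h1, ← Finset.sum_mul, E.p_sum, one_mul]

theorem next_high (W : List (Φ × RiskType) → RiskType → ℝ) (s : List Φ) (i : RiskType) :
    E.next W (highHistory s) i h
      = E.branch i (fun s => W (highHistory s) h) (fun s => W (highHistory s) l) s := by
  refine Finset.sum_congr rfl fun y _ => ?_
  rw [sum_riskType, add_comm]; rfl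

namespace Plan

variable {E} (P : E.Plan)

/-- Utility of a low type over `n` periods. -/
noncomputable def lowUtil (n : ℕ) (s : List Φ) : ℝ := E.annuity n * E.u (P.low s)

/-- Cost of a low type over `n` periods. -/
noncomputable def lowCost (n : ℕ) (s : List Φ) : ℝ := E.annuity n * P.low s

/-- Utility of a truthful high type over `n` periods. -/
noncomputable def util : ℕ → List Φ → ℝ
  | 0, _ => 0
  | n + 1, s => E.v (P.high s) h + E.δ * E.branch h (util n) (P.lowUtil n) s

/-- Cost of a truthful high type over `n` periods. -/
noncomputable def cost : ℕ → List Φ → ℝ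
  | 0, _ => 0
  | n + 1, s => E.cost (P.high s) h + E.δ * E.branch h (cost n) (P.lowCost n) s

/-- Utility over `n + 1` periods of a low type who reports to be high, and is truthful later. -/
noncomputable def threat (n : ℕ) (s : List Φ) : ℝ :=
  E.v (P.high s) l + E.δ * E.branch l (P.util n) (P.lowUtil n) s

/-- No low type gains from reporting to be high. -/
def NoMimicking : Prop :=
  ∀ n s, n + 1 + s.length = E.T → P.threat n s ≤ P.lowUtil (n + 1) s

/-- Consumption level promised by the first low-type report in the history, if any. -/
def absorbed : List (Φ × RiskType) → Option ℝ≥0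
  | [] => none
  -- The older history is consulted first, so the earliest low report decides. The signals in `η`
  -- are those known when that report was made.
  | (_, r) :: η => match absorbed η with
    | some c => some c
    | none => if r = l then some (P.low (η.map Prod.fst)) else none

/-- The direct mechanism that carries out a plan. -/
def mech : E.Mechanism := fun η θ => match P.absorbed η with
  | some c => E.const c
  | none => match θ with
    | h => P.high (η.map Prod.fst)
    | l => E.const (P.low (η.map Prod.fst))

theorem absorbed_highHistory (s : List Φ) : P.absorbed (highHistory s) = none := by
  induction s with
  | nil => rfl
  | cons φ s ih => rw [highHistory_cons, absorbed, ih]; rfl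

theorem map_fst_highHistory (s : List Φ) : (highHistory s).map Prod.fst = s := by
  simp [highHistory, Function.comp_def]

theorem mech_high (s : List Φ) : P.mech (highHistory s) h = P.high s := by
  simp only [mech, absorbed_highHistory, map_fst_highHistory]

theorem mech_low (s : List Φ) : P.mech (highHistory s) l = E.const (P.low s) := by
  simp only [mech, absorbed_highHistory, map_fst_highHistory]

theorem absorbed_low (s : List Φ) (φ : Φ) :
    P.absorbed ((φ, l) :: highHistory s) = some (P.low s) := by
  rw [absorbed, absorbed_highHistory, map_fst_highHistory]; rfl

theorem absorbed_cons {η : List (Φ × RiskType)} {c : ℝ≥0} (hη : P.absorbed η = some c)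
    (x : Φ × RiskType) : P.absorbed (x :: η) = some c := by
  obtain ⟨φ, r⟩ := x
  rw [absorbed, hη]

theorem mech_absorbed {η : List (Φ × RiskType)} {c : ℝ≥0} (hη : P.absorbed η = some c)
    (θ : RiskType) : P.mech η θ = E.const c := by
  simp only [mech, hη]

theorem total_flow_absorbed (n : ℕ) : ∀ {η : List (Φ × RiskType)} {c : ℝ≥0},
    P.absorbed η = some c → ∀ θ, E.total (E.flow P.mech) n η θ = E.annuity n * E.u c := by
  induction n with
  | zero => intros; simp [total, annuity]
  | succ n ih =>
    intro η c hη θ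
    rw [total, flow, P.mech_absorbed hη, v_const,
      E.next_const fun φ θ' => ih (P.absorbed_cons hη (φ, θ)) θ', annuity]
    ring

theorem total_cost_absorbed (n : ℕ) : ∀ {η : List (Φ × RiskType)} {c : ℝ≥0},
    P.absorbed η = some c → ∀ θ, E.total (E.flowCost P.mech) n η θ = E.annuity n * c := by
  induction n with
  | zero => intros; simp [total, annuity]
  | succ n ih =>
    intro η c hη θ
    rw [total, flowCost, P.mech_absorbed hη, cost_const,
      E.next_const fun φ θ' => ih (P.absorbed_cons hη (φ, θ)) θ', annuity]
    ring

theorem best_absorbed (n : ℕ) : ∀ {η : List (Φ × RiskType)} {c : ℝ≥0},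
    P.absorbed η = some c → ∀ θ, E.best P.mech n η θ = E.annuity n * E.u c := by
  induction n with
  | zero => intros; simp [best, annuity]
  | succ n ih =>
    intro η c hη θ
    simp only [best, P.mech_absorbed hη, v_const]
    rw [E.next_const fun φ θ' => ih (P.absorbed_cons hη (φ, h)) θ',
      E.next_const fun φ θ' => ih (P.absorbed_cons hη (φ, l)) θ', max_self, annuity]
    ring

theorem total_flow_low (n : ℕ) (s : List Φ) :
    E.total (E.flow P.mech) n (highHistory s) l = P.lowUtil n s := by
  cases n with
  | zero => simp [total, lowUtil, annuity]
  | succ n =>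
    rw [total, flow, mech_low, v_const,
      E.next_const fun φ θ' => P.total_flow_absorbed n (P.absorbed_low s φ) θ', lowUtil, annuity]
    ring

theorem total_cost_low (n : ℕ) (s : List Φ) :
    E.total (E.flowCost P.mech) n (highHistory s) l = P.lowCost n s := by
  cases n with
  | zero => simp [total, lowCost, annuity]
  | succ n =>
    rw [total, flowCost, mech_low, cost_const,
      E.next_const fun φ θ' => P.total_cost_absorbed n (P.absorbed_low s φ) θ', lowCost, annuity]
    ring

theorem total_flow_high (n : ℕ) : ∀ s : List Φ,
    E.total (E.flow P.mech) n (highHistory s) h = P.util n s := by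
  induction n with
  | zero => intros; rfl
  | succ n ih =>
    intro s
    rw [total, flow, mech_high, next_high, util,
      E.branch_congr fun φ => by rw [ih, total_flow_low]]

theorem total_cost_high (n : ℕ) : ∀ s : List Φ,
    E.total (E.flowCost P.mech) n (highHistory s) h = P.cost n s := by
  induction n with
  | zero => intros; rfl
  | succ n ih =>
    intro s
    rw [total, flowCost, mech_high, next_high, cost,
      E.branch_congr fun φ => by rw [ih, total_cost_low]]

theorem cost_nonneg (n : ℕ) (s : List Φ) : 0 ≤ P.cost n s := by
  rw [← total_cost_high]; exact E.total_cost_nonneg _ _ _ _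

theorem util_le (n : ℕ) (s : List Φ) :
    P.util n s ≤ E.annuity n * E.u (P.cost n s / E.annuity n) := by
  rw [← total_cost_high, ← total_flow_high]; exact E.total_flow_le _ _ _ _

theorem annuity_mul_u_zero_le_util (n : ℕ) (s : List Φ) :
    E.annuity n * E.u 0 ≤ P.util n s := by
  rw [← total_flow_high]; exact E.annuity_mul_u_zero_le_total _ _ _ _

/-- After a low report consumption is constant, so later reports are irrelevant. Backward induction
then leaves just two comparisons at each all-high history, and these are the two hypotheses. -/
theorem best_mech (hL : P.NoMimicking)
    (hH : ∀ n s, n + s.length = E.T → P.lowUtil n s ≤ P.util n s) (n : ℕ) :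
    ∀ s : List Φ, n + s.length = E.T → E.best P.mech n (highHistory s) h = P.util n s ∧
      E.best P.mech n (highHistory s) l = P.lowUtil n s := by
  induction n with
  | zero => intros; simp [best, util, lowUtil, annuity]
  | succ n ih =>
    intro s hs
    have hchild : ∀ φ : Φ, n + (φ :: s).length = E.T := fun φ => by
      simp only [List.length_cons]; omega
    have hlow : ∀ θ, E.next (E.best P.mech n) (highHistory s) θ l = E.annuity n * E.u (P.low s) :=
      fun θ => E.next_const fun φ θ' => P.best_absorbed n (P.absorbed_low s φ) θ'
    have hhigh : ∀ θ, E.next (E.best P.mech n) (highHistory s) θ h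
        = E.branch θ (P.util n) (P.lowUtil n) s := fun θ => by
      rw [next_high]
      exact E.branch_congr fun φ => by rw [(ih _ (hchild φ)).1, (ih _ (hchild φ)).2]
    have hl : E.u (P.low s) + E.δ * (E.annuity n * E.u (P.low s)) = P.lowUtil (n + 1) s := by
      rw [lowUtil, annuity]; ring
    simp only [best, hlow, hhigh, mech_high, mech_low, v_const, hl]
    exact ⟨max_eq_left (hH _ s hs), max_eq_right (hL n s hs)⟩

theorem incentiveCompatible_mech (hL : P.NoMimicking)
    (hH : ∀ n s, n + s.length = E.T → P.lowUtil n s ≤ P.util n s) :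
    E.IncentiveCompatible P.mech := by
  obtain ⟨h1, h2⟩ := P.best_mech hL hH E.T [] (by simp)
  rw [incentiveCompatible_iff]
  intro θ
  cases θ
  · exact h2.trans (P.total_flow_low E.T []).symm
  · exact h1.trans (P.total_flow_high E.T []).symm

end Plan

/-! ### Pooling restores the high type's incentives -/

theorem trans_h_l_lt : E.trans h l < E.trans l l := E.persistent l h (by decide)

namespace Plan

variable {E} (P : E.Plan)

open Classical in
/-- Consumption level at which the types are pooled after the signals `s`, if they are: pooling
starts the first time that the signal history lies in `B`, at the level `c`. -/
noncomputable def pooled (B : Set (List Φ)) (c : List Φ → ℝ≥0) : List Φ → Option ℝ≥0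
  -- The root is never pooled, so the prescribed initial utilities are untouched.
  | [] => none
  | φ :: s => match pooled B c s with
    | some x => some x
    | none => if φ :: s ∈ B then some (c (φ :: s)) else none

/-- The plan `P` modified by pooling the types forever once the signal history lies in `B`. -/
noncomputable def pool (B : Set (List Φ)) (c : List Φ → ℝ≥0) : E.Plan where
  high s := match pooled B c s with
    | some x => E.const x
    | none => P.high s
  low s := match pooled B c s with
    | some x => x
    | none => P.low s

section pool

variable {B : Set (List Φ)} {c : List Φ → ℝ≥0} {s : List Φ} {x : ℝ≥0}

theorem pooled_cons_of_some (hs : pooled B c s = some x) (φ : Φ) :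
    pooled B c (φ :: s) = some x := by
  rw [pooled, hs]

theorem pooled_cons_of_none (hs : pooled B c s = none) {φ : Φ} (hφ : φ :: s ∉ B) :
    pooled B c (φ :: s) = none := by
  rw [pooled, hs]; exact if_neg hφ

theorem pooled_cons_of_mem (hs : pooled B c s = none) {φ : Φ} (hφ : φ :: s ∈ B) :
    pooled B c (φ :: s) = some (c (φ :: s)) := by
  rw [pooled, hs]; exact if_pos hφ

theorem notMem_of_pooled_cons {φ : Φ} (hs : pooled B c (φ :: s) = none) : φ :: s ∉ B := by
  intro hB
  cases h1 : pooled B c s with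
  | none => rw [pooled_cons_of_mem h1 hB] at hs; cases hs
  | some x => rw [pooled_cons_of_some h1] at hs; cases hs

theorem pool_high_some (hs : pooled B c s = some x) : (P.pool B c).high s = E.const x := by
  simp only [pool, hs]

theorem pool_high_none (hs : pooled B c s = none) : (P.pool B c).high s = P.high s := by
  simp only [pool, hs]

theorem pool_low_some (hs : pooled B c s = some x) : (P.pool B c).low s = x := by
  simp only [pool, hs]

theorem pool_low_none (hs : pooled B c s = none) : (P.pool B c).low s = P.low s := by
  simp only [pool, hs]

theorem pool_lowUtil_some (n : ℕ) (hs : pooled B c s = some x) :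
    (P.pool B c).lowUtil n s = E.annuity n * E.u x := by
  rw [lowUtil, P.pool_low_some hs]

theorem pool_lowUtil_none (n : ℕ) (hs : pooled B c s = none) :
    (P.pool B c).lowUtil n s = P.lowUtil n s := by
  rw [lowUtil, P.pool_low_none hs, lowUtil]

theorem pool_lowCost_some (n : ℕ) (hs : pooled B c s = some x) :
    (P.pool B c).lowCost n s = E.annuity n * x := by
  rw [lowCost, P.pool_low_some hs]

theorem pool_lowCost_none (n : ℕ) (hs : pooled B c s = none) :
    (P.pool B c).lowCost n s = P.lowCost n s := by
  rw [lowCost, P.pool_low_none hs, lowCost]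

theorem pool_util_some (n : ℕ) : ∀ {s : List Φ}, pooled B c s = some x →
    (P.pool B c).util n s = E.annuity n * E.u x := by
  induction n with
  | zero => intros; simp [util, annuity]
  | succ n ih =>
    intro s hs
    rw [util, P.pool_high_some hs, v_const,
      E.branch_const (fun φ => ih (pooled_cons_of_some hs φ))
        (fun φ => P.pool_lowUtil_some n (pooled_cons_of_some hs φ)), annuity]
    ring

theorem pool_cost_some (n : ℕ) : ∀ {s : List Φ}, pooled B c s = some x →
    (P.pool B c).cost n s = E.annuity n * x := by
  induction n with
  | zero => intros; simp [cost, annuity]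
  | succ n ih =>
    intro s hs
    rw [cost, P.pool_high_some hs, cost_const,
      E.branch_const (fun φ => ih (pooled_cons_of_some hs φ))
        (fun φ => P.pool_lowCost_some n (pooled_cons_of_some hs φ)), annuity]
    ring

/-- The conditions under which pooling is neutral for a previous high type and saves costs. -/
def PoolSpec (B : Set (List Φ)) (c : List Φ → ℝ≥0) : Prop :=
  ∀ n s, n + s.length = E.T →
    (s ∈ B ↔ P.util n s < P.lowUtil n s) ∧
    E.annuity n * E.u (c s) = E.trans h h * P.util n s + E.trans h l * P.lowUtil n s ∧
    E.annuity n * c s ≤ E.trans h h * P.cost n s + E.trans h l * P.lowCost n s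

variable {P}

/-- Where pooling starts, the pooled level has the same expected utility, under the transition from
a high type, as the pair it replaces, and no larger expected cost. Backward induction carries both
facts to unpooled histories. -/
theorem pool_util_cost_none (hc : P.PoolSpec B c) (n : ℕ) : ∀ {s : List Φ},
    n + s.length = E.T → pooled B c s = none →
    (P.pool B c).util n s = P.util n s ∧ (P.pool B c).cost n s ≤ P.cost n s := by
  induction n with
  | zero => intros; exact ⟨rfl, le_rfl⟩
  | succ n ih =>
    intro s hn hs
    have hchild : ∀ φ : Φ, n + (φ :: s).length = E.T := fun φ => by
      simp only [List.length_cons]; omega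
    simp only [util, cost, P.pool_high_none hs]
    have key : ∀ φ : Φ,
        E.trans h h * (P.pool B c).util n (φ :: s) + E.trans h l * (P.pool B c).lowUtil n (φ :: s)
          = E.trans h h * P.util n (φ :: s) + E.trans h l * P.lowUtil n (φ :: s) ∧
        E.trans h h * (P.pool B c).cost n (φ :: s) + E.trans h l * (P.pool B c).lowCost n (φ :: s)
          ≤ E.trans h h * P.cost n (φ :: s) + E.trans h l * P.lowCost n (φ :: s) := by
      intro φ
      by_cases hB : φ :: s ∈ B
      · have h1 := pooled_cons_of_mem (c := c) hs hB
        rw [P.pool_util_some n h1, P.pool_cost_some n h1, P.pool_lowUtil_some n h1,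
          P.pool_lowCost_some n h1, ← add_mul, ← add_mul, add_comm (E.trans h h), E.trans_add,
          one_mul, one_mul]
        exact (hc n _ (hchild φ)).2
      · have h1 := pooled_cons_of_none (c := c) hs hB
        obtain ⟨h2, h3⟩ := ih (hchild φ) h1
        rw [h2, P.pool_lowUtil_none n h1, P.pool_lowCost_none n h1]
        exact ⟨rfl, add_le_add (mul_le_mul_of_nonneg_left h3 (E.trans_nonneg _ _)) le_rfl⟩
    exact ⟨by rw [E.branch_congr fun φ => (key φ).1],
      add_le_add le_rfl (mul_le_mul_of_nonneg_left (E.branch_mono fun φ => (key φ).2) E.δ_pos.le)⟩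

theorem noMimicking_pool (hc : P.PoolSpec B c) (hL : P.NoMimicking) :
    (P.pool B c).NoMimicking := by
  intro n s hn
  have hchild : ∀ φ : Φ, n + (φ :: s).length = E.T := fun φ => by
    simp only [List.length_cons]; omega
  cases hs : pooled B c s with
  | some x =>
    rw [threat, P.pool_high_some hs, v_const,
      E.branch_const (fun φ => P.pool_util_some n (pooled_cons_of_some hs φ))
        (fun φ => P.pool_lowUtil_some n (pooled_cons_of_some hs φ)),
      P.pool_lowUtil_some _ hs, annuity]
    exact le_of_eq (by ring)
  | none =>
    rw [P.pool_lowUtil_none _ hs]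
    refine le_trans ?_ (hL n s hn)
    rw [threat, P.pool_high_none hs]
    refine add_le_add le_rfl (mul_le_mul_of_nonneg_left (E.branch_mono fun φ => ?_) E.δ_pos.le)
    by_cases hB : φ :: s ∈ B
    · have h1 := pooled_cons_of_mem (c := c) hs hB
      obtain ⟨h2, h3, -⟩ := hc n _ (hchild φ)
      rw [P.pool_util_some n h1, P.pool_lowUtil_some n h1, h3]
      have h4 := h2.1 hB
      have e1 := E.trans_add h
      have e2 := E.trans_add l
      have e3 := E.trans_h_l_lt
      have e4 : E.trans h h = 1 - E.trans h l := by linarith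
      have e5 : E.trans l h = 1 - E.trans l l := by linarith
      rw [e4, e5]
      -- A former low type puts more weight on the low continuation, which is the larger one where
      -- pooling starts. Her loss from pooling is the product of the two positive differences.
      nlinarith [mul_pos (sub_pos.2 h4) (sub_pos.2 e3)]
    · have h1 := pooled_cons_of_none (c := c) hs hB
      rw [(pool_util_cost_none hc n (hchild φ) h1).1, P.pool_lowUtil_none n h1]

/-- Pooled types have equal values, and an unpooled nonempty history lies outside `B`, where the
inequality holds by definition. Only the root needs an assumption. -/
theorem lowUtil_le_util_pool (hc : P.PoolSpec B c) (h0 : P.lowUtil E.T [] ≤ P.util E.T [])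
    (n : ℕ) (s : List Φ) (hn : n + s.length = E.T) :
    (P.pool B c).lowUtil n s ≤ (P.pool B c).util n s := by
  cases hs : pooled B c s with
  | some x => rw [P.pool_util_some n hs, P.pool_lowUtil_some n hs]
  | none =>
    rw [(pool_util_cost_none hc n hn hs).1, P.pool_lowUtil_none n hs]
    cases s with
    | nil => simp only [List.length_nil, add_zero] at hn; rwa [hn]
    | cons φ s => exact not_lt.1 fun h1 => notMem_of_pooled_cons hs ((hc n _ hn).1.2 h1)

/-- The pooled level is the certainty equivalent of the lottery over next types faced by a high
type; Jensen bounds its cost. -/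
theorem exists_poolSpec (P : E.Plan) : ∃ B c, P.PoolSpec B c := by
  have hex : ∀ s : List Φ, ∃ c : ℝ≥0, ∀ n, n + s.length = E.T →
      E.annuity n * E.u c = E.trans h h * P.util n s + E.trans h l * P.lowUtil n s ∧
      E.annuity n * c ≤ E.trans h h * P.cost n s + E.trans h l * P.lowCost n s := by
    intro s
    obtain ⟨n, hn⟩ : ∃ n, n = E.T - s.length := ⟨_, rfl⟩
    rcases Nat.eq_zero_or_pos n with h0 | h0
    · refine ⟨0, fun m hm => ?_⟩
      obtain rfl : m = 0 := by omega
      simp [annuity, util, lowUtil, cost, lowCost]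
    have ha := E.annuity_pos h0.ne'
    have e1 := E.trans_add h
    have hk1 : 0 ≤ P.cost n s / E.annuity n := div_nonneg (P.cost_nonneg n s) ha.le
    have hk2 : (0 : ℝ) ≤ P.low s := (P.low s).2
    have hh := E.trans_nonneg h h
    have hl := E.trans_nonneg h l
    have hconc := E.u_concave hk1 hk2 hh hl (by linarith)
    have hu : P.util n s / E.annuity n ≤ E.u (P.cost n s / E.annuity n) := by
      rw [div_le_iff₀' ha]; exact P.util_le n s
    have hu0 : E.u 0 ≤ P.util n s / E.annuity n := by
      rw [le_div_iff₀' ha]; exact P.annuity_mul_u_zero_le_util n s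
    have hw0 := E.u_zero_le hk2
    obtain ⟨c, hc1, hc2⟩ := E.exists_u_eq (add_nonneg (mul_nonneg hh hk1) (mul_nonneg hl hk2))
      (x := E.trans h h * (P.util n s / E.annuity n) + E.trans h l * E.u (P.low s))
      (by
        have := mul_le_mul_of_nonneg_left hu0 hh
        have := mul_le_mul_of_nonneg_left hw0 hl
        have : E.u 0 = E.trans h h * E.u 0 + E.trans h l * E.u 0 := by
          rw [← add_mul, add_comm, e1, one_mul]
        linarith)
      (by
        have := mul_le_mul_of_nonneg_left hu hh
        linarith)
    refine ⟨c, fun m hm => ?_⟩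
    obtain rfl : m = n := by omega
    constructor
    · rw [hc1, lowUtil]; field_simp
    · refine (mul_le_mul_of_nonneg_left hc2 ha.le).trans_eq ?_
      rw [lowCost]; field_simp
  choose c hc using hex
  refine ⟨{s | P.util (E.T - s.length) s < P.lowUtil (E.T - s.length) s}, c, fun n s hn => ?_⟩
  obtain rfl : n = E.T - s.length := by omega
  exact ⟨Iff.rfl, hc s _ hn⟩

end pool

/-- An optimal mechanism costs no more than any plan that deters mimicking and delivers the same
initial utilities, since pooling makes such a plan incentive compatible at no extra cost. -/
theorem total_cost_le_of_isOptimal {P : E.Plan} {V : RiskType → ℝ} (hV : V l ≤ V h)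
    {M : E.Mechanism} (hM : E.IsOptimal V M) (hL : P.NoMimicking)
    (hh : P.util E.T [] = V h) (hl : P.lowUtil E.T [] = V l) :
    ∑ θ, E.init θ * E.total (E.flowCost M) E.T [] θ
      ≤ E.init l * P.lowCost E.T [] + E.init h * P.cost E.T [] := by
  obtain ⟨B, c, hc⟩ := P.exists_poolSpec
  have hroot : pooled B c [] = none := rfl
  obtain ⟨h1, h2⟩ := pool_util_cost_none hc E.T (s := []) (by simp) hroot
  have hIC := (P.pool B c).incentiveCompatible_mech (noMimicking_pool hc hL)
    (lowUtil_le_util_pool hc (by rw [hh, hl]; exact hV))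
  have hfeas : E.Feasible V (P.pool B c).mech := by
    refine ⟨hIC, fun θ => ?_⟩
    rw [initialUtility, contUtility_truthful]
    cases θ
    · exact ((P.pool B c).total_flow_low E.T []).trans ((P.pool_lowUtil_none E.T hroot).trans hl)
    · exact ((P.pool B c).total_flow_high E.T []).trans (h1.trans hh)
  have h3 := hM.2 _ hfeas
  rw [profit_eq, profit_eq, sub_le_sub_iff_left] at h3
  refine h3.trans ?_
  rw [sum_riskType]
  refine add_le_add (le_of_eq ?_) (mul_le_mul_of_nonneg_left ?_ (E.init_pos h).le)
  · congr 1
    exact ((P.pool B c).total_cost_low E.T []).trans (P.pool_lowCost_none E.T hroot)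
  · exact ((P.pool B c).total_cost_high E.T []).trans_le h2

end Plan

/-! ### Certainty equivalents of the low type's continuation -/

theorem branch_add_const {i : RiskType} {f g f' g' : List Φ → ℝ} {s : List Φ} {a b : ℝ}
    (hf : ∀ φ, f' (φ :: s) = f (φ :: s) + a) (hg : ∀ φ, g' (φ :: s) = g (φ :: s) + b) :
    E.branch i f' g' s = E.branch i f g s + (E.trans i h * a + E.trans i l * b) := by
  have h1 : E.branch i (fun _ => a) (fun _ => b) s = E.trans i h * a + E.trans i l * b := by
    simp only [branch, ← Finset.sum_mul, E.p_sum, one_mul]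
  rw [← h1, branch, branch, branch, ← Finset.sum_add_distrib]
  refine Finset.sum_congr rfl fun y _ => ?_
  rw [hf, hg]; ring

/-- Jensen read backwards: `u` is increasing, so constant consumption is the cheapest way to provide
a given lifetime utility. -/
theorem annuity_mul_le_total_cost {M : E.Mechanism} {n : ℕ} {η : List (Φ × RiskType)}
    {θ : RiskType} {c : ℝ≥0} (hc : E.annuity n * E.u c ≤ E.total (E.flow M) n η θ) :
    E.annuity n * c ≤ E.total (E.flowCost M) n η θ := by
  rcases eq_or_ne n 0 with rfl | hn
  · simp [annuity, total]
  · have ha := E.annuity_pos hn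
    rw [← le_div_iff₀' ha]
    exact (E.u_le_iff c.2 (div_nonneg (E.total_cost_nonneg M n η θ) ha.le)).1
      (le_of_mul_le_mul_left (hc.trans (E.total_flow_le M n η θ)) ha)

/-- `c s` is the certainty equivalent of a low type's optimal continuation value after `s`. -/
def LowEquiv (M : E.Mechanism) (c : List Φ → ℝ≥0) : Prop :=
  ∀ n s, n + s.length = E.T → E.annuity n * E.u (c s) = E.best M n (highHistory s) l

theorem exists_lowEquiv (M : E.Mechanism) : ∃ c, E.LowEquiv M c := by
  have hex : ∀ s : List Φ, ∃ c : ℝ≥0, ∀ n, n + s.length = E.T →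
      E.annuity n * E.u c = E.best M n (highHistory s) l := by
    intro s
    obtain ⟨n, hn⟩ : ∃ n, n = E.T - s.length := ⟨_, rfl⟩
    rcases Nat.eq_zero_or_pos n with h0 | h0
    · refine ⟨0, fun m hm => ?_⟩
      obtain rfl : m = 0 := by omega
      simp [annuity, best]
    have ha := E.annuity_pos h0.ne'
    obtain ⟨k, hk, hb⟩ := E.exists_best_le M n (highHistory s) l
    obtain ⟨c, hc, -⟩ := E.exists_u_eq (x := E.best M n (highHistory s) l / E.annuity n) hk
      (by rw [le_div_iff₀' ha]
          exact (E.annuity_mul_u_zero_le_total M n _ _).trans (E.total_le_best M n _ _))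
      (by rwa [div_le_iff₀' ha])
    refine ⟨c, fun m hm => ?_⟩
    obtain rfl : m = n := by omega
    rw [hc, mul_div_cancel₀ _ ha.ne']
  choose c hc using hex
  exact ⟨c, fun n s hn => hc s n hn⟩

theorem best_high_succ {M : E.Mechanism} (hM : E.IncentiveCompatible M) {n : ℕ} {s : List Φ}
    (hn : n + 1 + s.length = E.T) :
    E.best M (n + 1) (highHistory s) h = E.v (M (highHistory s) h) h
      + E.δ * E.branch h (fun s => E.best M n (highHistory s) h)
          (fun s => E.best M n (highHistory s) l) s := by
  rw [E.best_high hM s _ hn, total, next_high, flow]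
  congr 2
  refine E.branch_congr fun φ => ?_
  rw [E.trans_mul_best_low hM s φ n hn, E.best_high hM]
  simp only [List.length_cons]; omega

theorem mimic_le_best (M : E.Mechanism) (n : ℕ) (s : List Φ) :
    E.v (M (highHistory s) h) l + E.δ * E.branch l (fun s => E.best M n (highHistory s) h)
      (fun s => E.best M n (highHistory s) l) s ≤ E.best M (n + 1) (highHistory s) l := by
  rw [← next_high]; exact E.le_best_succ M n _ l h

theorem total_cost_high_succ (M : E.Mechanism) (n : ℕ) (s : List Φ) :
    E.total (E.flowCost M) (n + 1) (highHistory s) h = E.cost (M (highHistory s) h) h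
      + E.δ * E.branch h (fun s => E.total (E.flowCost M) n (highHistory s) h)
          (fun s => E.total (E.flowCost M) n (highHistory s) l) s := by
  rw [total, next_high, flowCost]

theorem LowEquiv.trans_mul_le {M : E.Mechanism} {c : List Φ → ℝ≥0} (hc : E.LowEquiv M c)
    (hM : E.IncentiveCompatible M) {n : ℕ} {s : List Φ} (hn : n + 1 + s.length = E.T) (φ : Φ) :
    E.trans h l * (E.annuity n * c (φ :: s))
      ≤ E.trans h l * E.total (E.flowCost M) n (highHistory (φ :: s)) l := by
  obtain h0 | h0 := (E.trans_nonneg h l).eq_or_lt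
  · rw [← h0]; simp
  · refine mul_le_mul_of_nonneg_left (E.annuity_mul_le_total_cost ?_) h0.le
    rw [hc n _ (by simp only [List.length_cons]; omega)]
    exact (mul_left_cancel₀ h0.ne' (E.trans_mul_best_low hM s φ n hn)).ge

/-! ### Admissible perturbations and their cost -/

/-- A modification of the contracts of `M` after the signals `s` and in the following period. -/
structure Perturbation (M : E.Mechanism) (c : List Φ → ℝ≥0) (n : ℕ) (s : List Φ) (a b : ℝ) where
  now : E.FlowContract
  high : List Φ → E.FlowContract
  low : List Φ → ℝ≥0
  -- Continuation values rise by `a` for high and `a - b` for low types next period. The expected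
  -- rise is `a - trans h l * b` from a high type and `a - trans l l * b` from a low one; today's
  -- contract takes back exactly these amounts.
  now_h : E.v now h = E.v (M (highHistory s) h) h - E.δ * (a - E.trans h l * b)
  now_l : E.v now l = E.v (M (highHistory s) h) l - E.δ * (a - E.trans l l * b)
  high_h : ∀ φ, E.v (high (φ :: s)) h = E.v (M (highHistory (φ :: s)) h) h + a
  -- This change equals that in `low_u`, so next period's gain from mimicking is unaffected.
  high_l : ∀ φ, E.v (high (φ :: s)) l = E.v (M (highHistory (φ :: s)) h) l + (a - b)
  low_u : ∀ φ, E.annuity n * E.u (low (φ :: s)) = E.annuity n * E.u (c (φ :: s)) + (a - b)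

namespace Perturbation

variable {E} {M : E.Mechanism} {c : List Φ → ℝ≥0} {n₀ : ℕ} {s₀ : List Φ} {a b : ℝ}
  (Q : E.Perturbation M c n₀ s₀ a b)

open Classical in
/-- The plan that modifies `M` by the perturbation and fully insures low types. -/
noncomputable def plan : E.Plan where
  -- Since `[].tail = []`, the case `x = s₀` must be separated from that of its successors when `s₀`
  -- is the root; the guard in `low` has the same purpose.
  high x := if x = s₀ then Q.now else if x.tail = s₀ then Q.high x else M (highHistory x) h
  low x := if x ≠ s₀ ∧ x.tail = s₀ then Q.low x else c x

theorem tail_ne {x : List Φ} (hx : x ≠ s₀) (hx' : ∀ φ, x ≠ φ :: s₀) : x.tail ≠ s₀ := by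
  cases x with
  | nil => exact hx
  | cons φ x => rintro rfl; exact hx' φ rfl

theorem cons_ne (φ : Φ) : φ :: s₀ ≠ s₀ := List.cons_ne_self φ s₀

theorem plan_high_self : Q.plan.high s₀ = Q.now := if_pos rfl

theorem plan_high_cons (φ : Φ) : Q.plan.high (φ :: s₀) = Q.high (φ :: s₀) := by
  simp [plan]

theorem plan_high_of_ne {x : List Φ} (hx : x ≠ s₀) (hx' : ∀ φ, x ≠ φ :: s₀) :
    Q.plan.high x = M (highHistory x) h := by
  simp [plan, hx, tail_ne hx hx']

theorem plan_low_cons (φ : Φ) : Q.plan.low (φ :: s₀) = Q.low (φ :: s₀) := by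
  simp [plan]

theorem plan_low_of_ne {x : List Φ} (hx' : ∀ φ, x ≠ φ :: s₀) : Q.plan.low x = c x := by
  by_cases hx : x = s₀
  · simp [plan, hx]
  · simp [plan, tail_ne hx hx']

theorem lowUtil_of_ne (hc : E.LowEquiv M c) {n : ℕ} {x : List Φ} (hn : n + x.length = E.T)
    (hx' : ∀ φ, x ≠ φ :: s₀) : Q.plan.lowUtil n x = E.best M n (highHistory x) l := by
  rw [Plan.lowUtil, Q.plan_low_of_ne hx', hc n x hn]

theorem lowUtil_cons (hc : E.LowEquiv M c) {n : ℕ} (hT : n₀ + 1 + s₀.length = E.T)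
    (hn : n + 1 + s₀.length = E.T) (φ : Φ) :
    Q.plan.lowUtil n (φ :: s₀) = E.best M n (highHistory (φ :: s₀)) l + (a - b) := by
  obtain rfl : n = n₀ := by omega
  rw [Plan.lowUtil, Q.plan_low_cons, Q.low_u, hc n _ (by simp only [List.length_cons]; omega)]

theorem child_ne {x : List Φ} (hx : x ≠ s₀) (ψ : Φ) : ∀ φ, ψ :: x ≠ φ :: s₀ := by
  intro φ h1; exact hx (List.cons.inj h1).2

theorem grandchild_ne (ψ φ : Φ) : ∀ φ', ψ :: φ :: s₀ ≠ φ' :: s₀ := child_ne (cons_ne φ) ψ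

/-- The perturbation is visible only at the successors of `s₀`: at `s₀` itself today's contract
offsets it, so all earlier values coincide with those under `M`. -/
theorem util_plan (hM : E.IncentiveCompatible M) (hc : E.LowEquiv M c) (hn₀ : n₀ ≠ 0)
    (hT : n₀ + 1 + s₀.length = E.T) (n : ℕ) :
    (∀ x : List Φ, n + x.length = E.T → (∀ φ, x ≠ φ :: s₀) →
      Q.plan.util n x = E.best M n (highHistory x) h) ∧
    (∀ φ, n + 1 + s₀.length = E.T →
      Q.plan.util n (φ :: s₀) = E.best M n (highHistory (φ :: s₀)) h + a) := by
  induction n with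
  | zero => exact ⟨fun _ _ _ => rfl, fun _ hn => absurd hn (by omega)⟩
  | succ n ih =>
    obtain ⟨ih1, ih2⟩ := ih
    have hlen : ∀ {x : List Φ} (ψ : Φ), n + 1 + x.length = E.T → n + (ψ :: x).length = E.T :=
      fun ψ hx => by simp only [List.length_cons]; omega
    constructor
    · intro x hn hx'
      rw [E.best_high_succ hM hn, Plan.util]
      by_cases hx : x = s₀
      · subst hx
        rw [Q.plan_high_self, Q.now_h, E.branch_add_const
          (f := fun s => E.best M n (highHistory s) h) (g := fun s => E.best M n (highHistory s) l)
          (fun ψ => ih2 ψ hn)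
          (fun ψ => Q.lowUtil_cons hc hT hn ψ)]
        have e1 : E.trans h h = 1 - E.trans h l := by linarith [E.trans_add h]
        rw [e1]; ring
      · rw [Q.plan_high_of_ne hx hx', E.branch_congr
          (f' := fun s => E.best M n (highHistory s) h)
          (g' := fun s => E.best M n (highHistory s) l) fun ψ => by
          rw [ih1 _ (hlen ψ hn) (child_ne hx ψ), Q.lowUtil_of_ne hc (hlen ψ hn) (child_ne hx ψ)]]
    · intro φ hn
      have hn' : n + 1 + (φ :: s₀).length = E.T := by simp only [List.length_cons]; omega
      rw [E.best_high_succ hM hn', Plan.util, Q.plan_high_cons, Q.high_h,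
        E.branch_congr
          (f' := fun s => E.best M n (highHistory s) h)
          (g' := fun s => E.best M n (highHistory s) l) fun ψ => by
          rw [ih1 _ (hlen ψ hn') (grandchild_ne ψ φ),
            Q.lowUtil_of_ne hc (hlen ψ hn') (grandchild_ne ψ φ)]]
      ring

/-- At `s₀` the offset leaves the mimicking value unchanged; at a successor both sides shift by `a -
b`. Elsewhere the constraint is that of `M`, with the best low continuation on both sides. -/
theorem noMimicking_plan (hM : E.IncentiveCompatible M) (hc : E.LowEquiv M c) (hn₀ : n₀ ≠ 0)
    (hT : n₀ + 1 + s₀.length = E.T) : Q.plan.NoMimicking := by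
  intro n x hn
  have hlen : ∀ ψ : Φ, n + (ψ :: x).length = E.T := fun ψ => by
    simp only [List.length_cons]; omega
  obtain ⟨h1, h2⟩ := Q.util_plan hM hc hn₀ hT n
  have hb := E.mimic_le_best M n x
  rw [Plan.threat]
  by_cases hx : x = s₀
  · subst hx
    rw [Q.plan_high_self, Q.now_l, E.branch_add_const
          (f := fun s => E.best M n (highHistory s) h) (g := fun s => E.best M n (highHistory s) l)
          (fun ψ => h2 ψ hn)
      (fun ψ => Q.lowUtil_cons hc hT hn ψ),
      Q.lowUtil_of_ne hc hn fun φ => (cons_ne φ).symm]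
    have e1 : E.trans l h = 1 - E.trans l l := by linarith [E.trans_add l]
    rw [e1]
    refine le_trans (le_of_eq ?_) hb
    ring
  · rw [E.branch_congr
          (f' := fun s => E.best M n (highHistory s) h)
          (g' := fun s => E.best M n (highHistory s) l) fun ψ => by
      rw [h1 _ (hlen ψ) (child_ne hx ψ), Q.lowUtil_of_ne hc (hlen ψ) (child_ne hx ψ)]]
    by_cases hx' : ∃ φ, x = φ :: s₀
    · obtain ⟨φ, rfl⟩ := hx'
      rw [Q.plan_high_cons, Q.high_l, Q.lowUtil_cons hc hT
        (by simp only [List.length_cons] at hn; omega)]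
      linarith
    · push Not at hx'
      rw [Q.plan_high_of_ne hx hx', Q.lowUtil_of_ne hc hn hx']
      exact hb

/-- Histories that are not suffixes of `s₀` never lead to it. There the plan keeps the high
contracts of `M`, and certainty equivalents can only lower the low type's cost. -/
theorem cost_plan_le (hM : E.IncentiveCompatible M) (hc : E.LowEquiv M c) (n : ℕ) :
    ∀ x : List Φ, n + x.length = E.T → ¬ x <:+ s₀ → (∀ φ, x ≠ φ :: s₀) →
      Q.plan.cost n x ≤ E.total (E.flowCost M) n (highHistory x) h := by
  induction n with
  | zero => intros; exact le_rfl
  | succ n ih =>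
    intro x hn hs hx'
    have hx : x ≠ s₀ := by rintro rfl; exact hs List.suffix_rfl
    rw [Plan.cost, total_cost_high_succ, Q.plan_high_of_ne hx hx']
    refine add_le_add le_rfl (mul_le_mul_of_nonneg_left (E.branch_mono fun ψ => ?_) E.δ_pos.le)
    refine add_le_add (mul_le_mul_of_nonneg_left (ih _ (by simp only [List.length_cons]; omega)
      (fun h1 => hs ((List.suffix_cons ψ x).trans h1)) (child_ne hx ψ)) (E.trans_nonneg _ _)) ?_
    rw [Plan.lowCost, Q.plan_low_of_ne (child_ne hx ψ)]
    exact hc.trans_mul_le E hM hn ψ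

/-- A saving at `s₀` passes back to the root, since each step towards `s₀` has positive probability
and no other branch is dearer. The list `t` holds the signals from `x` to `s₀` in chronological
order. -/
theorem cost_plan_lt (hM : E.IncentiveCompatible M) (hc : E.LowEquiv M c)
    (hT : n₀ + 1 + s₀.length = E.T)
    (hlt : Q.plan.cost (n₀ + 1) s₀ < E.total (E.flowCost M) (n₀ + 1) (highHistory s₀) h)
    (t : List Φ) : ∀ n (x : List Φ), n + x.length = E.T → t.reverse ++ x = s₀ →
      Q.plan.cost n x < E.total (E.flowCost M) n (highHistory x) h := by
  induction t with
  | nil =>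
    rintro n x hn rfl
    obtain rfl : n = n₀ + 1 := by simp only [List.reverse_nil, List.nil_append] at hT; omega
    exact hlt
  | cons φ t ih =>
    intro n x hn hx0
    simp only [List.reverse_cons, List.append_assoc, List.singleton_append] at hx0
    have hlen0 : s₀.length = t.length + (x.length + 1) := by rw [← hx0]; simp
    have hx : x ≠ s₀ := by rintro rfl; omega
    have hx' : ∀ ψ, x ≠ ψ :: s₀ := by
      rintro ψ rfl; simp only [List.length_cons] at hlen0; omega
    obtain ⟨n, rfl⟩ : ∃ m, n = m + 1 := ⟨n - 1, by omega⟩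
    have hlen : ∀ ψ : Φ, n + (ψ :: x).length = E.T := fun ψ => by
      simp only [List.length_cons]; omega
    have hstep := ih n (φ :: x) (hlen φ) hx0
    have hle : ∀ ψ, Q.plan.cost n (ψ :: x)
        ≤ E.total (E.flowCost M) n (highHistory (ψ :: x)) h := by
      intro ψ
      by_cases hψ : ψ = φ
      · rw [hψ]; exact hstep.le
      · refine Q.cost_plan_le hM hc n _ (hlen ψ) ?_ (child_ne hx ψ)
        intro h1
        have h2 : φ :: x <:+ s₀ := ⟨t.reverse, hx0⟩
        have h3 := List.suffix_of_suffix_length_le h1 h2 (by simp)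
        have h4 := h3.eq_of_length (by simp)
        exact hψ (List.cons.inj h4).1
    have hterm : ∀ ψ, E.trans h h * Q.plan.cost n (ψ :: x)
          + E.trans h l * Q.plan.lowCost n (ψ :: x)
        ≤ E.trans h h * E.total (E.flowCost M) n (highHistory (ψ :: x)) h
          + E.trans h l * E.total (E.flowCost M) n (highHistory (ψ :: x)) l := by
      intro ψ
      refine add_le_add (mul_le_mul_of_nonneg_left (hle ψ) (E.trans_nonneg _ _)) ?_
      rw [Plan.lowCost, Q.plan_low_of_ne (child_ne hx ψ)]
      exact hc.trans_mul_le E hM hn ψ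
    rw [Plan.cost, total_cost_high_succ, Q.plan_high_of_ne hx hx']
    refine add_lt_add_of_le_of_lt le_rfl (mul_lt_mul_of_pos_left ?_ E.δ_pos)
    obtain ⟨y, rfl⟩ := E.signal_surjective φ
    refine Finset.sum_lt_sum (fun y _ => mul_le_mul_of_nonneg_left (hterm _) (E.p_nonneg _ _))
      ⟨y, Finset.mem_univ _, mul_lt_mul_of_pos_left ?_ (E.p_h_pos y)⟩
    refine add_lt_add_of_lt_of_le (mul_lt_mul_of_pos_left hstep E.trans_h_h_pos) ?_
    rw [Plan.lowCost, Q.plan_low_of_ne (child_ne hx _)]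
    exact hc.trans_mul_le E hM hn _

/-- No perturbation lowers the expected cost from the period of the perturbation on. -/
theorem cost_le {V : RiskType → ℝ} (hV : V l ≤ V h) (hM : E.IsOptimal V M)
    (hc : E.LowEquiv M c) (hn₀ : n₀ ≠ 0) (hT : n₀ + 1 + s₀.length = E.T) :
    E.cost (M (highHistory s₀) h) h
        + E.δ * E.branch h (fun s => E.cost (M (highHistory s) h) h)
            (fun s => E.total (E.flowCost M) n₀ (highHistory s) l) s₀
      ≤ E.cost Q.now h + E.δ * E.branch h (fun s => E.cost (Q.high s) h)
            (fun s => E.annuity n₀ * Q.low s) s₀ := by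
  have hIC := hM.1.1
  have hVθ : ∀ θ, E.best M E.T [] θ = V θ := fun θ => by
    rw [(E.incentiveCompatible_iff M).1 hIC, ← hM.1.2 θ, initialUtility, contUtility_truthful]
    rfl
  have hnil : ∀ φ : Φ, [] ≠ φ :: s₀ := fun φ => (List.cons_ne_nil _ _).symm
  have hlow : Q.plan.lowUtil E.T [] = V l := by
    rw [Q.lowUtil_of_ne hc (by simp) hnil]; exact hVθ l
  have hopt := Plan.total_cost_le_of_isOptimal hV hM (Q.noMimicking_plan hIC hc hn₀ hT)
    (((Q.util_plan hIC hc hn₀ hT E.T).1 [] (by simp) hnil).trans (hVθ h)) hlow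
  have hlowc : Q.plan.lowCost E.T [] ≤ E.total (E.flowCost M) E.T [] l := by
    refine E.annuity_mul_le_total_cost ?_
    rw [← (E.incentiveCompatible_iff M).1 hIC, hVθ, ← hlow, Plan.lowUtil]
  rw [sum_riskType] at hopt
  have hroot : E.total (E.flowCost M) E.T [] h ≤ Q.plan.cost E.T [] := by
    have h1 := mul_le_mul_of_nonneg_left hlowc (E.init_pos l).le
    exact le_of_mul_le_mul_left (by linarith) (E.init_pos h)
  have hs₀ : E.total (E.flowCost M) (n₀ + 1) (highHistory s₀) h ≤ Q.plan.cost (n₀ + 1) s₀ := by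
    by_contra! hlt
    exact absurd hroot (not_le.2
      (Q.cost_plan_lt hIC hc hT hlt s₀.reverse E.T [] (by simp) (by simp)))
  obtain ⟨m, rfl⟩ : ∃ m, n₀ = m + 1 := ⟨n₀ - 1, by omega⟩
  rw [total_cost_high_succ, Plan.cost, Q.plan_high_self] at hs₀
  -- Two periods are unfolded: from the second period after `s₀` on, the plan costs no more than
  -- `M`, so these continuation costs can be dropped.
  have hchild : ∀ φ, Q.plan.cost (m + 1) (φ :: s₀)
        - E.total (E.flowCost M) (m + 1) (highHistory (φ :: s₀)) h
      ≤ E.cost (Q.high (φ :: s₀)) h - E.cost (M (highHistory (φ :: s₀)) h) h := by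
    intro φ
    have hφ : m + 1 + (φ :: s₀).length = E.T := by simp only [List.length_cons]; omega
    rw [total_cost_high_succ, Plan.cost, Q.plan_high_cons]
    have hle : E.branch h (Q.plan.cost m) (Q.plan.lowCost m) (φ :: s₀)
        ≤ E.branch h (fun s => E.total (E.flowCost M) m (highHistory s) h)
          (fun s => E.total (E.flowCost M) m (highHistory s) l) (φ :: s₀) := by
      refine E.branch_mono fun ψ => add_le_add (mul_le_mul_of_nonneg_left
        (Q.cost_plan_le hIC hc m _ (by simp only [List.length_cons] at hφ ⊢; omega) ?_
          (grandchild_ne ψ φ)) (E.trans_nonneg _ _)) ?_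
      · intro h1
        have := h1.length_le
        simp only [List.length_cons] at this
        omega
      · rw [Plan.lowCost, Q.plan_low_of_ne (grandchild_ne ψ φ)]
        exact hc.trans_mul_le E hIC hφ ψ
    have := mul_le_mul_of_nonneg_left hle E.δ_pos.le
    linarith
  have hbr : E.branch h (Q.plan.cost (m + 1)) (Q.plan.lowCost (m + 1)) s₀
      - E.branch h (fun s => E.total (E.flowCost M) (m + 1) (highHistory s) h)
          (fun s => E.total (E.flowCost M) (m + 1) (highHistory s) l) s₀
      ≤ E.branch h (fun s => E.cost (Q.high s) h) (fun s => E.annuity (m + 1) * Q.low s) s₀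
        - E.branch h (fun s => E.cost (M (highHistory s) h) h)
            (fun s => E.total (E.flowCost M) (m + 1) (highHistory s) l) s₀ := by
    simp only [branch, ← Finset.sum_sub_distrib, ← mul_sub]
    refine Finset.sum_le_sum fun y _ => mul_le_mul_of_nonneg_left ?_ (E.p_nonneg _ _)
    have h1 := mul_le_mul_of_nonneg_left (hchild (E.signal y)) (E.trans_nonneg h h)
    rw [Plan.lowCost, Q.plan_low_cons]
    linarith
  have := mul_le_mul_of_nonneg_left hbr E.δ_pos.le
  linarith

end Perturbation

end InsuranceModel

/-! ### Differentiability of the auxiliary cost -/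

open Filter Topology in
/-- A function that lies below a differentiable function, touches it at a point and is midpoint
convex there is differentiable at that point. -/
theorem hasFDerivAt_of_le_of_midpoint {F : Type*} [NormedAddCommGroup F] [NormedSpace ℝ F]
    {f g : F → ℝ} {g' : F →L[ℝ] ℝ} {x : F} (hg : HasFDerivAt g g' x)
    (hfg : ∀ᶠ y in 𝓝 x, f y ≤ g y) (hx : f x = g x)
    (hmid : ∀ᶠ d in 𝓝 (0 : F), 2 * f x ≤ f (x + d) + f (x - d)) : HasFDerivAt f g' x := by
  rw [hasFDerivAt_iff_isLittleO_nhds_zero] at hg ⊢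
  have hneg : Tendsto (fun d : F => -d) (𝓝 0) (𝓝 0) := by
    simpa using (continuous_neg (G := F)).tendsto 0
  have hg2 := (hg.comp_tendsto hneg).norm_left
  have hsum : (fun d => ‖g (x + d) - g x - g' d‖ + ‖g (x + -d) - g x - g' (-d)‖)
      =o[𝓝 0] fun d : F => d := by
    refine hg.norm_left.add ?_
    exact hg2.trans_isBigO (Asymptotics.isBigO_of_le _ fun d => by simp)
  refine Asymptotics.IsBigO.trans_isLittleO (Asymptotics.IsBigO.of_bound 1 ?_) hsum
  have hadd : Tendsto (fun d : F => x + d) (𝓝 0) (𝓝 x) := by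
    simpa using (continuous_const_add x).tendsto (0 : F)
  have h1 := hadd.eventually hfg
  -- The increment of `f` at `d` lies below that of `g`; by midpoint convexity it lies above `g x -
  -- g (x - d)`. So its remainder is bounded by the sum of the remainders of `g` at `d` and `-d`.
  filter_upwards [h1, hneg.eventually h1, hmid] with d hd1 hd2 hd3
  have e1 := le_abs_self (g (x + d) - g x - g' d)
  have e2 := le_abs_self (g (x + -d) - g x - g' (-d))
  have e3 := abs_nonneg (g (x + d) - g x - g' d)
  have e4 := abs_nonneg (g (x + -d) - g x - g' (-d))
  rw [← sub_eq_add_neg] at *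
  rw [map_neg] at *
  simp only [Real.norm_eq_abs, one_mul]
  rw [abs_of_nonneg (add_nonneg e3 e4), abs_le]
  constructor <;> linarith

theorem sum_mul_update {ι α : Type*} [Fintype ι] [DecidableEq ι] (w : ι → ℝ) (f : α → ℝ)
    (z : ι → α) (i : ι) (a : α) :
    ∑ j, w j * f (Function.update z i a j) = ∑ j, w j * f (z j) + w i * (f a - f (z i)) := by
  have h1 : ∀ j, w j * f (Function.update z i a j)
      = w j * f (z j) + if j = i then w i * (f a - f (z i)) else 0 := by
    intro j
    by_cases hj : j = i
    · subst hj; simp; ring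
    · simp [hj]
  simp only [h1, Finset.sum_add_distrib, Finset.sum_ite_eq', Finset.mem_univ, if_true]

namespace InsuranceModel

variable {Φ : Type*} (E : InsuranceModel Φ)

section

open Filter Topology

theorem exists_localInverse {c : ℝ} (hc : 0 < c) : ∃ g : ℝ → ℝ, DifferentiableAt ℝ g (E.u c) ∧
    g (E.u c) = c ∧ ∀ᶠ x in 𝓝 (E.u c), 0 < g x ∧ E.u (g x) = x := by
  have hd : ContDiffAt ℝ 2 E.u c := E.u_contDiff.contDiffAt (Ici_mem_nhds hc)
  have hs : HasStrictDerivAt E.u (deriv E.u c) c := hd.hasStrictDerivAt (by norm_num)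
  -- Strict monotonicity alone allows a zero derivative; by concavity the derivative dominates the
  -- positive slope of the chord to `c + 1`.
  have hpos : 0 < deriv E.u c := by
    have h1 : slope E.u c (c + 1) ≤ deriv E.u c :=
      E.u_strictConcave.concaveOn.slope_le_deriv hc.le (by simp; linarith)
        (by linarith) hs.hasDerivAt.differentiableAt
    have h2 : E.u c < E.u (c + 1) := E.u_strictMono hc.le (by simp; linarith) (by linarith)
    rw [slope_def_field] at h1
    have h3 : 0 < (E.u (c + 1) - E.u c) / (c + 1 - c) := div_pos (by linarith) (by linarith)
    linarith
  have hinv := hs.to_localInverse hpos.ne'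
  have hval : hs.localInverse E.u (deriv E.u c) c hpos.ne' (E.u c) = c :=
    (hs.hasStrictFDerivAt_equiv hpos.ne').localInverse_apply_image
  refine ⟨hs.localInverse E.u (deriv E.u c) c hpos.ne', hinv.hasDerivAt.differentiableAt, hval, ?_⟩
  have hcont := hinv.hasDerivAt.differentiableAt.continuousAt
  have h1 : ∀ᶠ x in 𝓝 (E.u c), 0 < hs.localInverse E.u (deriv E.u c) c hpos.ne' x :=
    hcont.eventually (by rw [hval]; exact lt_mem_nhds hc)
  exact h1.and (hs.hasStrictFDerivAt_equiv hpos.ne').eventually_right_inverse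

theorem v_update (z : E.FlowContract) (y : E.Y) (a : ℝ≥0) (i : RiskType) :
    E.v (Function.update z y a) i = E.v z i + E.p i y * (E.u a - E.u (z y)) :=
  sum_mul_update (E.p i) (fun a : ℝ≥0 => E.u a) z y a

theorem cost_update (z : E.FlowContract) (y : E.Y) (a : ℝ≥0) (i : RiskType) :
    E.cost (Function.update z y a) i = E.cost z i + E.p i y * (a - z y) :=
  sum_mul_update (E.p i) (fun a : ℝ≥0 => (a : ℝ)) z y a

theorem χ_bddBelow (ν Δ : ℝ) :
    BddBelow {c : ℝ | ∃ z : E.FlowContract, E.Delivers z ν Δ ∧ c = ∑ y, E.p h y * (z y : ℝ)} :=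
  ⟨0, by rintro _ ⟨z, -, rfl⟩; exact E.cost_nonneg z h⟩

theorem χ_le {z : E.FlowContract} {ν Δ : ℝ} (hz : E.Delivers z ν Δ) : E.χ ν Δ ≤ E.cost z h :=
  csInf_le (E.χ_bddBelow ν Δ) ⟨z, hz, rfl⟩

theorem le_χ {ν Δ x : ℝ} (hA : (ν, Δ) ∈ E.A)
    (hx : ∀ z : E.FlowContract, E.Delivers z ν Δ → x ≤ E.cost z h) : x ≤ E.χ ν Δ := by
  obtain ⟨z, hz⟩ := hA
  exact le_csInf ⟨_, z, hz, rfl⟩ (by rintro _ ⟨z, hz, rfl⟩; exact hx z hz)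

theorem exists_cost_lt {ν Δ ε : ℝ} (hA : (ν, Δ) ∈ E.A) (hε : 0 < ε) :
    ∃ z : E.FlowContract, E.Delivers z ν Δ ∧ E.cost z h < E.χ ν Δ + ε := by
  by_contra! hcon
  have := E.le_χ hA hcon
  linarith

/-- Averaging two contracts in utility, state by state, delivers the midpoint, and concavity of `u`
makes it no dearer than the average cost. -/
theorem two_mul_χ_le {q d : ℝ × ℝ} (h1 : q + d ∈ E.A) (h2 : q - d ∈ E.A) :
    2 * E.χ q.1 q.2 ≤ E.χ (q + d).1 (q + d).2 + E.χ (q - d).1 (q - d).2 := by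
  rw [← sub_le_iff_le_add]
  refine E.le_χ (Prod.mk.eta ▸ h1) fun z₁ hz₁ => ?_
  rw [sub_le_comm]
  refine E.le_χ (Prod.mk.eta ▸ h2) fun z₂ hz₂ => ?_
  have hex : ∀ y, ∃ c : ℝ≥0, E.u c = 1 / 2 * E.u (z₁ y) + 1 / 2 * E.u (z₂ y) ∧
      (c : ℝ) ≤ 1 / 2 * z₁ y + 1 / 2 * z₂ y := by
    intro y
    have hy1 : E.u 0 ≤ E.u ((z₁ y : ℝ≥0) : ℝ) := E.u_zero_le (z₁ y).2
    have hy2 : E.u 0 ≤ E.u ((z₂ y : ℝ≥0) : ℝ) := E.u_zero_le (z₂ y).2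
    exact E.exists_u_eq (by positivity) (by linarith) (E.u_concave (z₁ y).2 (z₂ y).2
      (by norm_num) (by norm_num) (by norm_num))
  choose z hz hzc using hex
  have hv : ∀ i, E.v z i = 1 / 2 * E.v z₁ i + 1 / 2 * E.v z₂ i := by
    intro i
    simp only [v, hz, Finset.mul_sum, ← Finset.sum_add_distrib]
    exact Finset.sum_congr rfl fun y _ => by ring
  have hc : E.cost z h ≤ 1 / 2 * E.cost z₁ h + 1 / 2 * E.cost z₂ h := by
    simp only [cost, Finset.mul_sum, ← Finset.sum_add_distrib]
    refine Finset.sum_le_sum fun y _ => ?_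
    have := mul_le_mul_of_nonneg_left (hzc y) (E.p_nonneg h y)
    linarith
  have hdel : E.Delivers z q.1 q.2 := by
    obtain ⟨a1, a2⟩ := hz₁
    obtain ⟨b1, b2⟩ := hz₂
    simp only [Prod.fst_add, Prod.snd_add, Prod.fst_sub, Prod.snd_sub] at a1 a2 b1 b2
    constructor
    · rw [hv, a1, b1]; ring
    · rw [hv, a2, b2]; ring
  have := E.χ_le hdel
  linarith

/-- The auxiliary cost is differentiable where an optimal contract has positive consumption at two
incomes with different likelihood ratios. -/
theorem χDifferentiableAt_of_two {z : E.FlowContract} {ν Δ : ℝ} (hz : E.Delivers z ν Δ)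
    (hmin : E.cost z h ≤ E.χ ν Δ) {y₁ y₂ : E.Y} (h₁ : 0 < z y₁) (h₂ : 0 < z y₂)
    (hdet : E.p h y₁ * E.p l y₂ - E.p h y₂ * E.p l y₁ ≠ 0) : E.χDifferentiableAt ν Δ := by
  obtain ⟨g₁, hg₁, hg₁v, hg₁e⟩ := E.exists_localInverse (NNReal.coe_pos.2 h₁)
  obtain ⟨g₂, hg₂, hg₂v, hg₂e⟩ := E.exists_localInverse (NNReal.coe_pos.2 h₂)
  have hy : y₂ ≠ y₁ := by rintro rfl; exact hdet (by ring)
  set D := E.p h y₁ * E.p l y₂ - E.p h y₂ * E.p l y₁ with hD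
  -- By Cramer's rule, `x₁` and `x₂` are the utilities at the two incomes that deliver `q` with the
  -- rest of `z` fixed.
  let x₁ : ℝ × ℝ → ℝ := fun q => E.u (z y₁)
    + (E.p l y₂ * (q.1 - ν) - E.p h y₂ * ((q.1 - q.2) - (ν - Δ))) / D
  let x₂ : ℝ × ℝ → ℝ := fun q => E.u (z y₂)
    + (E.p h y₁ * ((q.1 - q.2) - (ν - Δ)) - E.p l y₁ * (q.1 - ν)) / D
  have hx₁v : x₁ (ν, Δ) = E.u (z y₁) := by simp [x₁]
  have hx₂v : x₂ (ν, Δ) = E.u (z y₂) := by simp [x₂]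
  have hx₁ : Differentiable ℝ x₁ := by fun_prop
  have hx₂ : Differentiable ℝ x₂ := by fun_prop
  let G : ℝ × ℝ → ℝ := fun q => E.cost z h + E.p h y₁ * (g₁ (x₁ q) - z y₁)
    + E.p h y₂ * (g₂ (x₂ q) - z y₂)
  have hG : DifferentiableAt ℝ G (ν, Δ) := by
    have e1 : DifferentiableAt ℝ (fun q => g₁ (x₁ q)) (ν, Δ) :=
      DifferentiableAt.comp (ν, Δ) (by rwa [hx₁v]) (hx₁ _)
    have e2 : DifferentiableAt ℝ (fun q => g₂ (x₂ q)) (ν, Δ) :=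
      DifferentiableAt.comp (ν, Δ) (by rwa [hx₂v]) (hx₂ _)
    change DifferentiableAt ℝ (fun q => E.cost z h + E.p h y₁ * (g₁ (x₁ q) - z y₁)
      + E.p h y₂ * (g₂ (x₂ q) - z y₂)) (ν, Δ)
    exact ((((e1.sub_const _).const_mul _).const_add _)).add ((e2.sub_const _).const_mul _)
  have ht₁ : Tendsto x₁ (𝓝 (ν, Δ)) (𝓝 (E.u (z y₁))) := by
    rw [← hx₁v]; exact (hx₁ _).continuousAt
  have ht₂ : Tendsto x₂ (𝓝 (ν, Δ)) (𝓝 (E.u (z y₂))) := by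
    rw [← hx₂v]; exact (hx₂ _).continuousAt
  have hnear : ∀ᶠ q in 𝓝 (ν, Δ), ∃ z' : E.FlowContract,
      E.Delivers z' q.1 q.2 ∧ E.cost z' h = G q := by
    filter_upwards [ht₁.eventually hg₁e, ht₂.eventually hg₂e] with q hq₁ hq₂
    obtain ⟨c₁, hc₁⟩ : ∃ c₁ : ℝ≥0, (c₁ : ℝ) = g₁ (x₁ q) := ⟨_, Real.coe_toNNReal _ hq₁.1.le⟩
    obtain ⟨c₂, hc₂⟩ : ∃ c₂ : ℝ≥0, (c₂ : ℝ) = g₂ (x₂ q) := ⟨_, Real.coe_toNNReal _ hq₂.1.le⟩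
    refine ⟨Function.update (Function.update z y₁ c₁) y₂ c₂, ⟨?_, ?_⟩, ?_⟩
    · rw [v_update, v_update, Function.update_of_ne hy, hz.1]
      rw [hc₁, hc₂, hq₁.2, hq₂.2]
      simp only [x₁, x₂]
      field_simp
      rw [hD]; ring
    · rw [v_update, v_update, Function.update_of_ne hy, hz.2]
      rw [hc₁, hc₂, hq₁.2, hq₂.2]
      simp only [x₁, x₂]
      field_simp
      rw [hD]; ring
    · rw [cost_update, cost_update, Function.update_of_ne hy, hc₁, hc₂]
  have hmid : ∀ᶠ d in 𝓝 (0 : ℝ × ℝ), 2 * E.χ ν Δ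
      ≤ E.χ ((ν, Δ) + d).1 ((ν, Δ) + d).2 + E.χ ((ν, Δ) - d).1 ((ν, Δ) - d).2 := by
    have hadd : Tendsto (fun d : ℝ × ℝ => (ν, Δ) + d) (𝓝 0) (𝓝 (ν, Δ)) := by
      simpa using (continuous_const_add (ν, Δ)).tendsto (0 : ℝ × ℝ)
    have hsub : Tendsto (fun d : ℝ × ℝ => (ν, Δ) - d) (𝓝 0) (𝓝 (ν, Δ)) := by
      have : Continuous fun d : ℝ × ℝ => (ν, Δ) - d := by fun_prop
      simpa using this.tendsto 0
    filter_upwards [hadd.eventually hnear, hsub.eventually hnear] with d hd1 hd2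
    obtain ⟨z₁, hz₁, -⟩ := hd1
    obtain ⟨z₂, hz₂, -⟩ := hd2
    exact E.two_mul_χ_le (q := (ν, Δ)) ⟨z₁, hz₁⟩ ⟨z₂, hz₂⟩
  refine (hasFDerivAt_of_le_of_midpoint hG.hasFDerivAt ?_ ?_ hmid).differentiableAt
  · filter_upwards [hnear] with q hq
    obtain ⟨z', hz', hcost⟩ := hq
    exact (E.χ_le hz').trans_eq hcost
  · have hGv : G (ν, Δ) = E.cost z h := by
      simp only [G, hx₁v, hx₂v, hg₁v, hg₂v, sub_self, mul_zero, add_zero]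
    rw [hGv]
    exact le_antisymm (E.χ_le hz) hmin

theorem χDifferentiableAt.hasDerivAt_line {ν Δ : ℝ} (hd : E.χDifferentiableAt ν Δ) (a b : ℝ) :
    HasDerivAt (fun ε => E.χ (ν + a * ε) (Δ + b * ε)) (a * E.χν ν Δ + b * E.χΔ ν Δ) 0 := by
  obtain ⟨L, hL⟩ := hd
  have key : ∀ a b : ℝ, HasDerivAt (fun ε => E.χ (ν + a * ε) (Δ + b * ε)) (L (a, b)) 0 := by
    intro a b
    have h1 : HasDerivAt (fun ε : ℝ => (ν + a * ε, Δ + b * ε)) (a, b) 0 := by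
      have e1 : HasDerivAt (fun ε : ℝ => ν + a * ε) a 0 := by
        simpa using ((hasDerivAt_id (0 : ℝ)).const_mul a).const_add ν
      have e2 : HasDerivAt (fun ε : ℝ => Δ + b * ε) b 0 := by
        simpa using ((hasDerivAt_id (0 : ℝ)).const_mul b).const_add Δ
      exact e1.prodMk e2
    exact HasFDerivAt.comp_hasDerivAt (f := fun ε : ℝ => (ν + a * ε, Δ + b * ε)) 0
      (by simpa using hL) h1
  have hν : E.χν ν Δ = L (1, 0) := by
    have h1 := key 1 0
    simp only [one_mul, zero_mul, add_zero] at h1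
    have h3 : HasDerivAt (fun x => E.χ x Δ) (L (1, 0)) ν := by
      have := HasDerivAt.comp_sub_const (f := fun ε => E.χ (ν + ε) Δ) ν ν (by simpa using h1)
      simpa using this
    exact h3.deriv
  have hΔ : E.χΔ ν Δ = L (0, 1) := by
    have h1 := key 0 1
    simp only [one_mul, zero_mul, add_zero] at h1
    have h3 : HasDerivAt (fun x => E.χ ν x) (L (0, 1)) Δ := by
      have := HasDerivAt.comp_sub_const (f := fun ε => E.χ ν (Δ + ε)) Δ Δ (by simpa using h1)
      simpa using this
    exact h3.deriv
  have hab : L (a, b) = a * L (1, 0) + b * L (0, 1) := by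
    have : ((a, b) : ℝ × ℝ) = a • (1, 0) + b • (0, 1) := by simp
    rw [this, map_add, map_smul, map_smul, smul_eq_mul, smul_eq_mul]
  rw [hν, hΔ, ← hab]
  exact key a b

/-- Proportional distributions are equal, which the strict inequality of means excludes. -/
theorem exists_det_ne_zero :
    ∃ y₁ y₂ : E.Y, E.p h y₁ * E.p l y₂ - E.p h y₂ * E.p l y₁ ≠ 0 := by
  by_contra! hcon
  have heq : ∀ y, E.p h y = E.p l y := by
    intro y
    have h1 : ∑ y₂, (E.p h y * E.p l y₂ - E.p h y₂ * E.p l y) = 0 :=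
      Finset.sum_eq_zero fun y₂ _ => hcon y y₂
    rw [Finset.sum_sub_distrib, ← Finset.mul_sum, ← Finset.sum_mul, E.p_sum, E.p_sum] at h1
    linarith
  have hlt := E.mean_lt
  simp only [heq] at hlt
  exact absurd hlt (lt_irrefl _)

theorem const_delivers (c : ℝ≥0) : E.Delivers (E.const c) (E.u c) 0 := by
  constructor <;> simp [v_const]

/-- Without distortion full insurance is cheapest by Jensen, so `χ · 0` inverts `u`. -/
theorem χ_const (c : ℝ≥0) : E.χ (E.u c) 0 = c := by
  refine le_antisymm ((E.χ_le (E.const_delivers c)).trans_eq (E.cost_const c h)) ?_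
  refine E.le_χ ⟨_, E.const_delivers c⟩ fun z hz => ?_
  have h1 := E.v_le_u_cost z h
  rw [hz.1] at h1
  exact (E.u_le_iff c.2 (E.cost_nonneg z h)).1 h1

theorem χDifferentiableAt_const {c : ℝ≥0} (hc : 0 < c) : E.χDifferentiableAt (E.u c) 0 := by
  obtain ⟨y₁, y₂, hdet⟩ := E.exists_det_ne_zero
  exact E.χDifferentiableAt_of_two (E.const_delivers c) (by rw [cost_const, χ_const])
    (y₁ := y₁) (y₂ := y₂) hc hc hdet

theorem χν_const {c : ℝ≥0} {g : ℝ → ℝ}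
    (hg : ∀ᶠ x in 𝓝 (E.u c), 0 < g x ∧ E.u (g x) = x) :
    E.χν (E.u c) 0 = deriv g (E.u c) := by
  refine Filter.EventuallyEq.deriv_eq ?_
  filter_upwards [hg] with x hx
  obtain ⟨c', hc'⟩ : ∃ c' : ℝ≥0, (c' : ℝ) = g x := ⟨_, Real.coe_toNNReal _ hx.1.le⟩
  have := E.χ_const c'
  rwa [hc', hx.2] at this

/-! ### Optimal contracts in the interior of `A` -/

/-- In the interior of `A`, an optimal contract has positive consumption at two incomes with
different likelihood ratios. -/
theorem exists_two_of_mem_interior {z : E.FlowContract} {ν Δ : ℝ} (hz : E.Delivers z ν Δ)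
    (hmin : E.cost z h ≤ E.χ ν Δ) (hA : (ν, Δ) ∈ interior E.A) :
    ∃ y₁ y₂, 0 < z y₁ ∧ 0 < z y₂ ∧ E.p h y₁ * E.p l y₂ - E.p h y₂ * E.p l y₁ ≠ 0 := by
  by_contra! hcon
  have hnhds := mem_interior_iff_mem_nhds.1 hA
  have hline : ∀ a b : ℝ, ∃ ε > 0, (ν + a * ε, Δ + b * ε) ∈ E.A := by
    intro a b
    have hcont : Tendsto (fun ε : ℝ => (ν + a * ε, Δ + b * ε)) (𝓝[>] 0) (𝓝 (ν, Δ)) := by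
      have : Continuous (fun ε : ℝ => (ν + a * ε, Δ + b * ε)) := by fun_prop
      simpa using (this.tendsto 0).mono_left nhdsWithin_le_nhds
    obtain ⟨ε, h1, h2⟩ := ((hcont.eventually hnhds).and self_mem_nhdsWithin).exists
    exact ⟨ε, h2, h1⟩
  obtain ⟨y₀, hy₀⟩ : ∃ y, 0 < z y := by
    by_contra! hzero
    obtain ⟨ε, hε, z', hz'⟩ := hline (-1) 0
    have h1 := E.u_zero_le_v z' h
    have h2 : E.v z h = E.u 0 := by
      have : z = E.const 0 := funext fun y => le_antisymm (hzero y) bot_le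
      rw [this, v_const, NNReal.coe_zero]
    rw [hz'.1] at h1
    rw [hz.1] at h2
    simp only at h1
    linarith
  -- the deviation of the likelihood ratio at `y` from that at `y₀`
  let k : E.Y → ℝ := fun y => E.p h y₀ * E.p l y - E.p h y * E.p l y₀
  have hk : ∀ y, k y ≠ 0 → z y = 0 := by
    intro y hy
    by_contra hne
    exact hy (hcon y₀ y hy₀ (pos_iff_ne_zero.2 hne))
  -- Under the contrary assumption `z` vanishes wherever `k` does not, so this linear combination of
  -- the two flow utilities takes its zero-consumption value at `z`. Interiority lets it move both
  -- ways, so `k` takes both signs.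
  have hF : ∀ z' : E.FlowContract, E.p h y₀ * E.v z' l - E.p l y₀ * E.v z' h
      = (E.p h y₀ - E.p l y₀) * E.u 0 + ∑ y, k y * (E.u (z' y) - E.u 0) := by
    intro z'
    have h1 : ∑ y, k y = E.p h y₀ - E.p l y₀ := by
      simp only [k, Finset.sum_sub_distrib, ← Finset.mul_sum, ← Finset.sum_mul, E.p_sum]; ring
    rw [← h1]
    simp only [mul_sub, Finset.sum_sub_distrib, ← Finset.sum_mul, v, Finset.mul_sum, k, sub_mul]
    rw [add_sub_cancel]
    congr 1 <;> exact Finset.sum_congr rfl fun y _ => by ring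
  have hFz : E.p h y₀ * E.v z l - E.p l y₀ * E.v z h = (E.p h y₀ - E.p l y₀) * E.u 0 := by
    rw [hF, add_eq_left]
    refine Finset.sum_eq_zero fun y _ => ?_
    by_cases hy : k y = 0
    · rw [hy, zero_mul]
    · rw [hk y hy, NNReal.coe_zero, sub_self, mul_zero]
  have hpos : ∀ z' : E.FlowContract, ∀ y, 0 ≤ E.u (z' y) - E.u 0 := fun z' y =>
    sub_nonneg.2 (E.u_zero_le (z' y).2)
  obtain ⟨y₁, hy₁⟩ : ∃ y, 0 < k y := by
    by_contra! hneg
    obtain ⟨ε, hε, z', hz'⟩ := hline 0 (-1)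
    have h1 := hF z'
    have h2 : ∑ y, k y * (E.u (z' y) - E.u 0) ≤ 0 :=
      Finset.sum_nonpos fun y _ => mul_nonpos_of_nonpos_of_nonneg (hneg y) (hpos z' y)
    rw [hz'.1, hz'.2] at h1
    rw [hz.1, hz.2] at hFz
    simp only at h1
    nlinarith [mul_pos (E.p_h_pos y₀) hε]
  obtain ⟨y₂, hy₂⟩ : ∃ y, k y < 0 := by
    by_contra! hneg
    obtain ⟨ε, hε, z', hz'⟩ := hline 0 1
    have h1 := hF z'
    have h2 : 0 ≤ ∑ y, k y * (E.u (z' y) - E.u 0) :=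
      Finset.sum_nonneg fun y _ => mul_nonneg (hneg y) (hpos z' y)
    rw [hz'.1, hz'.2] at h1
    rw [hz.1, hz.2] at hFz
    simp only at h1
    nlinarith [mul_pos (E.p_h_pos y₀) hε]
  have h01 : y₁ ≠ y₀ := by rintro rfl; simp [k] at hy₁
  have h02 : y₂ ≠ y₀ := by rintro rfl; simp [k] at hy₂
  have h12 : y₂ ≠ y₁ := by rintro rfl; exact lt_asymm hy₁ hy₂
  have hp₀ := E.p_h_pos y₀
  have hp₁ := E.p_h_pos y₁
  have hp₂ := E.p_h_pos y₂
  -- shift utility from `y₀` to `y₁` and `y₂`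
  set m := (E.p h y₁ * (-k y₂) + E.p h y₂ * k y₁) / E.p h y₀ with hm
  have hmpos : 0 < m := div_pos (add_pos (mul_pos hp₁ (neg_pos.2 hy₂)) (mul_pos hp₂ hy₁)) hp₀
  have hz₀ : (0 : ℝ) < z y₀ := hy₀
  set mid : ℝ := (z y₀ : ℝ) / 2 with hmid
  have hmid0 : 0 < mid := by positivity
  have hmid1 : mid < z y₀ := by rw [hmid]; linarith
  have hum0 : E.u 0 < E.u mid := (E.u_lt_iff le_rfl hmid0.le).2 hmid0
  have hum1 : E.u mid < E.u (z y₀) := (E.u_lt_iff hmid0.le hz₀.le).2 hmid1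
  obtain ⟨ε, ⟨hε1, hε2, hε3⟩, hε⟩ : ∃ ε : ℝ, (E.u 0 + ε * (-k y₂) < E.u mid ∧
      E.u 0 + ε * k y₁ < E.u mid ∧ E.u mid < E.u (z y₀) - ε * m) ∧ 0 < ε := by
    have e1 : ∀ᶠ ε : ℝ in 𝓝[>] 0, E.u 0 + ε * (-k y₂) < E.u mid := by
      have : Continuous fun ε : ℝ => E.u 0 + ε * (-k y₂) := by fun_prop
      exact ((this.tendsto 0).mono_left nhdsWithin_le_nhds).eventually_lt_const (by simpa)
    have e2 : ∀ᶠ ε : ℝ in 𝓝[>] 0, E.u 0 + ε * k y₁ < E.u mid := by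
      have : Continuous fun ε : ℝ => E.u 0 + ε * k y₁ := by fun_prop
      exact ((this.tendsto 0).mono_left nhdsWithin_le_nhds).eventually_lt_const (by simpa)
    have e3 : ∀ᶠ ε : ℝ in 𝓝[>] 0, E.u mid < E.u (z y₀) - ε * m := by
      have : Continuous fun ε : ℝ => E.u (z y₀) - ε * m := by fun_prop
      exact ((this.tendsto 0).mono_left nhdsWithin_le_nhds).eventually_const_lt (by simpa)
    exact ((e1.and (e2.and e3)).and self_mem_nhdsWithin).exists
  have hd1 : 0 < ε * (-k y₂) := mul_pos hε (neg_pos.2 hy₂)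
  have hd2 : 0 < ε * k y₁ := mul_pos hε hy₁
  have hd0 : 0 < ε * m := mul_pos hε hmpos
  obtain ⟨c₁, hc₁, hc₁m⟩ := E.exists_u_eq hmid0.le (by linarith) hε1.le
  obtain ⟨c₂, hc₂, hc₂m⟩ := E.exists_u_eq hmid0.le (by linarith) hε2.le
  obtain ⟨c₀, hc₀, hc₀m⟩ := E.exists_u_eq (x := E.u (z y₀) - ε * m) hz₀.le
    (by linarith) (by linarith)
  have hc₀mid : mid < c₀ := (E.u_lt_iff hmid0.le c₀.2).1 (by rw [NNReal.val_eq_coe, hc₀]; exact hε3)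
  have hc₀lt : (c₀ : ℝ) < z y₀ := (E.u_lt_iff c₀.2 hz₀.le).1 (by
    rw [NNReal.val_eq_coe, hc₀]; linarith)
  have hσ : 0 < ε * m / (z y₀ - c₀) := div_pos hd0 (by linarith)
  -- `mid` separates the new consumption at `y₁`, `y₂` from that at `y₀`; by strict concavity
  -- utility is cheaper near zero than on the chord from `c₀` to `z y₀`, so the shift saves cost.
  have hslope : ∀ (c : ℝ≥0) (d : ℝ), 0 < d → E.u c = E.u 0 + d → (c : ℝ) ≤ mid →
      ε * m / (z y₀ - c₀) * c < d := by
    intro c d hd hcd hcm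
    have hcpos : (0 : ℝ) < c := (E.u_lt_iff le_rfl c.2).1 (by
      rw [NNReal.val_eq_coe, hcd]; linarith)
    have s1 := E.u_strictConcave.slope_anti_adjacent (x := 0) (y := (c : ℝ)) (z := c₀)
      (by simp) (by simp) hcpos (by linarith)
    have s2 := E.u_strictConcave.slope_anti_adjacent (x := (c : ℝ)) (y := c₀) (z := z y₀)
      (by simp) (by simp) (by linarith) hc₀lt
    have s3 := s2.trans s1
    rw [hc₀, hcd] at s3
    have e1 : E.u (z y₀) - (E.u (z y₀) - ε * m) = ε * m := by ring
    have e2 : E.u 0 + d - E.u 0 = d := by ring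
    rw [e1, e2, sub_zero] at s3
    rwa [lt_div_iff₀ hcpos] at s3
  have hs1 := hslope c₁ _ hd1 hc₁ hc₁m
  have hs2 := hslope c₂ _ hd2 hc₂ hc₂m
  have hz1 : z y₁ = 0 := hk y₁ hy₁.ne'
  have hz2 : z y₂ = 0 := hk y₂ hy₂.ne
  let z' : E.FlowContract := Function.update (Function.update (Function.update z y₀ c₀) y₁ c₁) y₂ c₂
  have hv' : ∀ i, E.v z' i = E.v z i - E.p i y₀ * (ε * m) + E.p i y₁ * (ε * (-k y₂))
      + E.p i y₂ * (ε * k y₁) := by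
    intro i
    simp only [z', v_update, Function.update_of_ne h12, Function.update_of_ne h02,
      Function.update_of_ne h01, hz1, hz2, hc₀, hc₁, hc₂, NNReal.coe_zero]
    ring
  have hcost' : E.cost z' h = E.cost z h - E.p h y₀ * (z y₀ - c₀) + E.p h y₁ * c₁
      + E.p h y₂ * c₂ := by
    simp only [z', cost_update, Function.update_of_ne h12, Function.update_of_ne h02,
      Function.update_of_ne h01, hz1, hz2, NNReal.coe_zero]
    ring
  have hmul : E.p h y₀ * m = E.p h y₁ * (-k y₂) + E.p h y₂ * k y₁ := by
    rw [hm]; field_simp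
  have hdel : E.Delivers z' ν Δ := by
    constructor
    · rw [hv', hz.1]
      linear_combination (-ε) * hmul
    · rw [hv', hz.2]
      have : E.p h y₀ * (E.p l y₀ * m) = E.p h y₀ * (E.p l y₁ * (-k y₂) + E.p l y₂ * k y₁) := by
        calc E.p h y₀ * (E.p l y₀ * m) = E.p l y₀ * (E.p h y₀ * m) := by ring
          _ = _ := by rw [hmul]; simp only [k]; ring
      have := mul_left_cancel₀ hp₀.ne' this
      linear_combination (-ε) * this
  have hlt : E.cost z' h < E.cost z h := by
    have key : ε * m / (z y₀ - c₀) * (E.p h y₁ * c₁ + E.p h y₂ * c₂)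
        < ε * m / (z y₀ - c₀) * (E.p h y₀ * (z y₀ - c₀)) := by
      have e1 : ε * m / (z y₀ - c₀) * (E.p h y₀ * (z y₀ - c₀)) = ε * (E.p h y₀ * m) := by
        have : (z y₀ - c₀ : ℝ) ≠ 0 := by linarith
        field_simp
      rw [e1, hmul]
      nlinarith [mul_lt_mul_of_pos_left hs1 hp₁, mul_lt_mul_of_pos_left hs2 hp₂]
    have := lt_of_mul_lt_mul_left key hσ.le
    rw [hcost']; linarith
  exact absurd (hmin.trans (E.χ_le hdel)) (not_le.2 hlt)

theorem χDifferentiableAt_of_mem_interior {z : E.FlowContract} {ν Δ : ℝ}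
    (hz : E.Delivers z ν Δ) (hmin : E.cost z h ≤ E.χ ν Δ) (hA : (ν, Δ) ∈ interior E.A) :
    E.χDifferentiableAt ν Δ := by
  obtain ⟨y₁, y₂, h₁, h₂, hdet⟩ := E.exists_two_of_mem_interior hz hmin hA
  exact E.χDifferentiableAt_of_two hz hmin h₁ h₂ hdet

theorem u_zero_lt_v_low {z : E.FlowContract} {ν Δ : ℝ} (hz : E.Delivers z ν Δ)
    (hA : (ν, Δ) ∈ interior E.A) : E.u 0 < E.v z l := by
  have hcont : Tendsto (fun ε : ℝ => (ν, Δ + ε)) (𝓝[>] 0) (𝓝 (ν, Δ)) := by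
    have : Continuous (fun ε : ℝ => (ν, Δ + ε)) := by fun_prop
    simpa using (this.tendsto 0).mono_left nhdsWithin_le_nhds
  obtain ⟨ε, ⟨z', hz'⟩, hε⟩ := ((hcont.eventually (mem_interior_iff_mem_nhds.1 hA)).and
    self_mem_nhdsWithin).exists
  have h1 := E.u_zero_le_v z' l
  have hε' : (0 : ℝ) < ε := hε
  rw [hz'.2] at h1
  rw [hz.2]
  simp only at h1
  linarith

end

/-! ### First-order conditions -/

/-- Equality in Jensen's inequality: a constant certainty equivalent is consumed right away. -/
theorem v_eq_of_total_eq {M : E.Mechanism} {n : ℕ} {η : List (Φ × RiskType)} {θ : RiskType}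
    {c : ℝ≥0} (hu : E.total (E.flow M) (n + 1) η θ = E.annuity (n + 1) * E.u c)
    (hc : E.total (E.flowCost M) (n + 1) η θ = E.annuity (n + 1) * c) :
    E.v (M η θ) θ = E.u c := by
  set X := E.cost (M η θ) θ with hX
  set C := E.next (E.total (E.flowCost M) n) η θ θ with hC
  have hX0 : 0 ≤ X := E.cost_nonneg _ _
  have hC0 : 0 ≤ C := E.next_nonneg fun _ _ => E.total_cost_nonneg M n _ _
  have hc' : X + E.δ * C = E.annuity (n + 1) * c := hc
  have hu' : E.v (M η θ) θ + E.δ * E.next (E.total (E.flow M) n) η θ θ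
      = E.annuity (n + 1) * E.u c := hu
  have hv : E.v (M η θ) θ ≤ E.u X := E.v_le_u_cost _ _
  rcases eq_or_ne n 0 with rfl | hn
  · rw [E.next_const (W := E.total (E.flow M) 0) (c := 0) fun _ _ => rfl] at hu'
    simpa [annuity] using hu'
  have ha := E.annuity_pos hn
  have hp := E.annuity_pos n.succ_ne_zero
  have hR0 : 0 ≤ C / E.annuity n := div_nonneg hC0 ha.le
  have hnx : E.next (E.total (E.flow M) n) η θ θ ≤ E.annuity n * E.u (C / E.annuity n) :=
    E.next_le_u (E.annuity_nonneg n) (fun φ θ' => E.total_cost_nonneg M n ((φ, θ) :: η) θ')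
      (fun φ θ' => E.total_flow_le M n _ _)
  have hnx' := mul_le_mul_of_nonneg_left hnx E.δ_pos.le
  have hann : E.annuity (n + 1) = 1 + E.δ * E.annuity n := rfl
  have hcomb : 1 / E.annuity (n + 1) * X + E.δ * E.annuity n / E.annuity (n + 1)
      * (C / E.annuity n) = c := by
    rw [eq_comm, ← mul_right_inj' hp.ne', ← hc']
    field_simp
  have hsum : 1 / E.annuity (n + 1) + E.δ * E.annuity n / E.annuity (n + 1) = 1 := by
    rw [← add_div]; exact div_self hp.ne'
  -- If current and average later costs differed, strict concavity would make the utility exceed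
  -- what this cost can buy.
  have hXR : X = C / E.annuity n := by
    by_contra hne
    have h1 := E.u_strictConcave.2 hX0 hR0 hne (one_div_pos.2 hp)
      (div_pos (mul_pos E.δ_pos ha) hp) hsum
    simp only [smul_eq_mul] at h1
    rw [hcomb] at h1
    have h2 := mul_lt_mul_of_pos_left h1 hp
    have h3 : E.annuity (n + 1) * (1 / E.annuity (n + 1) * E.u X + E.δ * E.annuity n
        / E.annuity (n + 1) * E.u (C / E.annuity n))
        = E.u X + E.δ * (E.annuity n * E.u (C / E.annuity n)) := by field_simp
    rw [h3] at h2
    linarith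
  have hXc : X = c := by
    rw [← hXR, ← add_mul, hsum, one_mul] at hcomb
    exact hcomb
  rw [← hXR, hXc] at hnx'
  rw [hXc] at hv
  rw [hann] at hu'
  linarith

theorem delivers_self (M : E.Mechanism) (s : List Φ) :
    E.Delivers (M (highHistory s) h) (E.flowUtility M s) (E.distortion M s) :=
  ⟨rfl, (sub_sub_cancel _ _).symm⟩

/-- The setting of the first-order conditions: an optimal mechanism and a history with at least
two remaining periods. -/
structure Setting (V : RiskType → ℝ) (M : E.Mechanism) (c : List Φ → ℝ≥0) (n : ℕ) (s : List Φ) :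
    Prop where
  le : V l ≤ V h
  optimal : E.IsOptimal V M
  lowEquiv : E.LowEquiv M c
  ne_zero : n ≠ 0
  length : n + 1 + s.length = E.T

namespace Setting

variable {E} {V : RiskType → ℝ} {M : E.Mechanism} {c : List Φ → ℝ≥0} {n : ℕ} {s : List Φ}

theorem cost_le (S : E.Setting V M c n s)
    {a b : ℝ} {z : E.FlowContract} {z' : Φ → E.FlowContract} {c' : Φ → ℝ≥0}
    (hz : E.Delivers z (E.flowUtility M s + -(E.δ * (a - E.trans h l * b)))
      (E.distortion M s + -(E.δ * (E.trans l l - E.trans h l) * b)))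
    (hz' : ∀ φ, E.Delivers (z' φ) (E.flowUtility M (φ :: s) + a) (E.distortion M (φ :: s) + b))
    (hc' : ∀ φ, E.u (c' φ) = E.u (c (φ :: s)) + (a - b) / E.annuity n) :
    E.cost (M (highHistory s) h) h + E.δ * ∑ y, E.p h y *
        (E.trans h h * E.cost (M (highHistory (E.signal y :: s)) h) h
          + E.trans h l * E.total (E.flowCost M) n (highHistory (E.signal y :: s)) l)
      ≤ E.cost z h + E.δ * ∑ y, E.p h y * (E.trans h h * E.cost (z' (E.signal y)) h
          + E.trans h l * (E.annuity n * c' (E.signal y))) := by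
  have ha := E.annuity_pos S.ne_zero
  let Q : E.Perturbation M c n s a b :=
    { now := z
      high := fun x => match x with
        -- The values at `[]` are never read, since only successors of `s` are perturbed here.
        | [] => z
        | φ :: _ => z' φ
      low := fun x => match x with
        | [] => 0
        | φ :: _ => c' φ
      now_h := by rw [hz.1]; simp only [flowUtility]; ring
      now_l := by rw [hz.2]; simp only [flowUtility, distortion]; ring
      high_h := fun φ => by rw [(hz' φ).1]; simp only [flowUtility]
      high_l := fun φ => by rw [(hz' φ).2]; simp only [flowUtility, distortion]; ring
      low_u := fun φ => by
        change E.annuity n * E.u (c' φ) = _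
        rw [hc']; field_simp }
  exact Q.cost_le S.le S.optimal S.lowEquiv S.ne_zero S.length

theorem trans_mul_le (S : E.Setting V M c n s) (φ : Φ) : E.trans h l * (E.annuity n * c (φ :: s))
    ≤ E.trans h l * E.total (E.flowCost M) n (highHistory (φ :: s)) l :=
  S.lowEquiv.trans_mul_le E S.optimal.1.1 S.length φ

theorem cost_le_of_fixed (S : E.Setting V M c n s) {z : E.FlowContract} {z' : Φ → E.FlowContract}
    (hz : E.Delivers z (E.flowUtility M s) (E.distortion M s))
    (hz' : ∀ φ, E.Delivers (z' φ) (E.flowUtility M (φ :: s)) (E.distortion M (φ :: s))) :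
    E.cost (M (highHistory s) h) h + E.δ * ∑ y, E.p h y *
        (E.trans h h * E.cost (M (highHistory (E.signal y :: s)) h) h
          + E.trans h l * E.total (E.flowCost M) n (highHistory (E.signal y :: s)) l)
      ≤ E.cost z h + E.δ * ∑ y, E.p h y * (E.trans h h * E.cost (z' (E.signal y)) h
          + E.trans h l * (E.annuity n * c (E.signal y :: s))) := by
  refine S.cost_le (a := 0) (b := 0) (c' := fun φ => c (φ :: s)) ?_ (fun φ => ?_) fun φ => ?_
  · simpa only [mul_zero, sub_zero, neg_zero, add_zero] using hz
  · simpa only [add_zero] using hz' φ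
  · rw [sub_zero, zero_div, add_zero]

theorem cost_le_χ (S : E.Setting V M c n s) (hA : (E.flowUtility M s, E.distortion M s) ∈ E.A) :
    E.cost (M (highHistory s) h) h ≤ E.χ (E.flowUtility M s) (E.distortion M s) := by
  refine E.le_χ hA fun z hz => ?_
  have h1 := S.cost_le_of_fixed hz fun φ => E.delivers_self M (φ :: s)
  have h2 := mul_le_mul_of_nonneg_left (Finset.sum_le_sum fun y (_ : y ∈ Finset.univ) =>
    mul_le_mul_of_nonneg_left (add_le_add_right (S.trans_mul_le (E.signal y))
      (E.trans h h * E.cost (M (highHistory (E.signal y :: s)) h) h)) (E.p_nonneg h y)) E.δ_pos.le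
  linarith

theorem cost_le_χ_cons (S : E.Setting V M c n s) (φ : Φ)
    (hA : (E.flowUtility M (φ :: s), E.distortion M (φ :: s)) ∈ E.A) :
    E.cost (M (highHistory (φ :: s)) h) h
      ≤ E.χ (E.flowUtility M (φ :: s)) (E.distortion M (φ :: s)) := by
  classical
  refine E.le_χ hA fun z hz => ?_
  by_contra! hlt
  let z' : Φ → E.FlowContract := Function.update (fun φ => M (highHistory (φ :: s)) h) φ z
  have hz' : ∀ ψ, E.Delivers (z' ψ) (E.flowUtility M (ψ :: s)) (E.distortion M (ψ :: s)) := by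
    intro ψ
    by_cases hψ : ψ = φ
    · subst hψ; simpa [z'] using hz
    · simpa [z', hψ] using E.delivers_self M (ψ :: s)
  have hle : ∀ ψ, E.cost (z' ψ) h ≤ E.cost (M (highHistory (ψ :: s)) h) h := by
    intro ψ
    by_cases hψ : ψ = φ
    · subst hψ; simpa [z'] using hlt.le
    · simp [z', hψ]
  have h1 := S.cost_le_of_fixed (E.delivers_self M s) hz'
  obtain ⟨y, rfl⟩ := E.signal_surjective φ
  refine absurd h1 (not_le.2 (add_lt_add_right (mul_lt_mul_of_pos_left ?_ E.δ_pos) _))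
  refine Finset.sum_lt_sum (fun y _ => mul_le_mul_of_nonneg_left (add_le_add
    (mul_le_mul_of_nonneg_left (hle _) (E.trans_nonneg _ _)) (S.trans_mul_le _)) (E.p_nonneg _ _))
    ⟨y, Finset.mem_univ _, mul_lt_mul_of_pos_left (add_lt_add_of_lt_of_le
      (mul_lt_mul_of_pos_left ?_ E.trans_h_h_pos) (S.trans_mul_le _)) (E.p_h_pos y)⟩
  simpa [z'] using hlt

/-- After the first low-type report, the optimal mechanism provides full insurance. -/
theorem lowFlowUtility_eq (S : E.Setting V M c n s) (hpos : 0 < E.trans h l) (φ : Φ) :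
    E.lowFlowUtility M (φ :: s) = E.u (c (φ :: s)) := by
  have hle : E.annuity n * c (φ :: s)
      ≤ E.total (E.flowCost M) n (highHistory (φ :: s)) l :=
    le_of_mul_le_mul_left (S.trans_mul_le φ) hpos
  have hcost : E.total (E.flowCost M) n (highHistory (φ :: s)) l
      = E.annuity n * c (φ :: s) := by
    refine (hle.eq_of_not_lt fun hlt => ?_).symm
    have h1 := S.cost_le_of_fixed (E.delivers_self M s) fun φ => E.delivers_self M (φ :: s)
    obtain ⟨y, rfl⟩ := E.signal_surjective φ
    refine absurd h1 (not_le.2 (add_lt_add_right (mul_lt_mul_of_pos_left ?_ E.δ_pos) _))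
    exact Finset.sum_lt_sum (fun y _ => mul_le_mul_of_nonneg_left (add_le_add le_rfl
      (S.trans_mul_le _)) (E.p_nonneg _ _)) ⟨y, Finset.mem_univ _, mul_lt_mul_of_pos_left
        (add_lt_add_right (mul_lt_mul_of_pos_left hlt hpos) _) (E.p_h_pos y)⟩
  have hutil : E.total (E.flow M) n (highHistory (φ :: s)) l
      = E.annuity n * E.u (c (φ :: s)) := by
    rw [S.lowEquiv n _ (by have := S.length; simp only [List.length_cons]; omega)]
    exact mul_left_cancel₀ hpos.ne' (E.trans_mul_best_low S.optimal.1.1 s φ n S.length)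
  obtain ⟨m, rfl⟩ := Nat.exists_eq_succ_of_ne_zero S.ne_zero
  exact E.v_eq_of_total_eq hutil hcost

/-- In the interior, the high contract gives a low type more than `u 0`; mimicking therefore bounds
her best value strictly above that of zero consumption. This keeps perturbed consumption nonnegative
even if low types are never reached. -/
theorem low_pos (S : E.Setting V M c n s) (φ : Φ)
    (hA : (E.flowUtility M (φ :: s), E.distortion M (φ :: s)) ∈ interior E.A) :
    0 < c (φ :: s) := by
  have h1 := E.u_zero_lt_v_low (E.delivers_self M (φ :: s)) hA
  have h2 := S.lowEquiv n (φ :: s) (by have := S.length; simp only [List.length_cons]; omega)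
  have ha := E.annuity_pos S.ne_zero
  obtain ⟨m, rfl⟩ := Nat.exists_eq_succ_of_ne_zero S.ne_zero
  have h3 := E.le_best_succ M m (highHistory (φ :: s)) l h
  have h4 : E.annuity m * E.u 0 ≤ E.next (E.best M m) (highHistory (φ :: s)) l h := by
    rw [← E.next_const (W := fun _ _ => E.annuity m * E.u 0) (η := highHistory (φ :: s)) (θ := l)
      (r := h) fun _ _ => rfl]
    exact E.next_mono fun _ _ =>
      (E.annuity_mul_u_zero_le_total M m _ _).trans (E.total_le_best M m _ _)
  have h5 := mul_le_mul_of_nonneg_left h4 E.δ_pos.le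
  have h6 : E.annuity (m + 1) * E.u 0 < E.annuity (m + 1) * E.u (c (φ :: s)) := by
    rw [h2]
    have : E.annuity (m + 1) * E.u 0 = E.u 0 + E.δ * (E.annuity m * E.u 0) := by
      rw [annuity]; ring
    linarith
  exact_mod_cast (E.u_lt_iff le_rfl (c (φ :: s)).2).1 (lt_of_mul_lt_mul_left h6 ha.le)

section

open Filter Topology

/-- First-order condition for perturbations that raise next period's flow utility at the rate `a`
and next period's distortion at the rate `b`. -/
theorem first_order (S : E.Setting V M c n s) [Finite Φ]
    (hA : (E.flowUtility M s, E.distortion M s) ∈ interior E.A)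
    (hA' : ∀ φ, (E.flowUtility M (φ :: s), E.distortion M (φ :: s)) ∈ interior E.A)
    (hd : E.χDifferentiableAt (E.flowUtility M s) (E.distortion M s))
    (hd' : ∀ φ, E.χDifferentiableAt (E.flowUtility M (φ :: s)) (E.distortion M (φ :: s)))
    (a b : ℝ) :
    -(E.δ * (a - E.trans h l * b)) * E.χν (E.flowUtility M s) (E.distortion M s)
      + -(E.δ * (E.trans l l - E.trans h l) * b) * E.χΔ (E.flowUtility M s) (E.distortion M s)
      + E.δ * ∑ y, E.p h y * (E.trans h h *
          (a * E.χν (E.flowUtility M (E.signal y :: s)) (E.distortion M (E.signal y :: s))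
            + b * E.χΔ (E.flowUtility M (E.signal y :: s)) (E.distortion M (E.signal y :: s)))
        + E.trans h l * ((a - b) * E.χν (E.u (c (E.signal y :: s))) 0)) = 0 := by
  have hann := E.annuity_pos S.ne_zero
  have hex := fun φ => E.exists_localInverse (NNReal.coe_pos.2 (S.low_pos φ (hA' φ)))
  choose g hg hgv hge using hex
  let A := -(E.δ * (a - E.trans h l * b))
  let B := -(E.δ * (E.trans l l - E.trans h l) * b)
  let r := (a - b) / E.annuity n
  -- `K` prices the perturbation of size `ε`, with every perturbed high contract at its minimal cost
  -- `χ`.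
  let K : ℝ → ℝ := fun ε =>
    E.χ (E.flowUtility M s + A * ε) (E.distortion M s + B * ε) + E.δ * ∑ y, E.p h y *
      (E.trans h h * E.χ (E.flowUtility M (E.signal y :: s) + a * ε)
          (E.distortion M (E.signal y :: s) + b * ε)
        + E.trans h l * (E.annuity n * g (E.signal y) (E.u (c (E.signal y :: s)) + r * ε)))
  have hlow : ∀ φ, HasDerivAt (fun ε => g φ (E.u (c (φ :: s)) + r * ε))
      (E.χν (E.u (c (φ :: s))) 0 * r) 0 := by
    intro φ
    have e1 : HasDerivAt (fun ε : ℝ => E.u (c (φ :: s)) + r * ε) r 0 := by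
      simpa using ((hasDerivAt_id (0 : ℝ)).const_mul r).const_add (E.u (c (φ :: s)))
    rw [E.χν_const (hge φ)]
    refine HasDerivAt.comp (h := fun ε : ℝ => E.u (c (φ :: s)) + r * ε) 0 ?_ e1
    simpa using (hg φ).hasDerivAt
  have hK : HasDerivAt K _ 0 := ((hd.hasDerivAt_line E A B).add
    ((HasDerivAt.fun_sum fun y (_ : y ∈ Finset.univ) =>
      ((((hd' (E.signal y)).hasDerivAt_line E a b).const_mul (E.trans h h)).add
        (((hlow (E.signal y)).const_mul (E.annuity n)).const_mul (E.trans h l))).const_mul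
          (E.p h y)).const_mul E.δ))
  have hK0 : K 0 ≤ E.cost (M (highHistory s) h) h + E.δ * ∑ y, E.p h y *
        (E.trans h h * E.cost (M (highHistory (E.signal y :: s)) h) h
          + E.trans h l * E.total (E.flowCost M) n (highHistory (E.signal y :: s)) l) := by
    simp only [K, mul_zero, add_zero, hgv]
    exact add_le_add (E.χ_le (E.delivers_self M s)) (mul_le_mul_of_nonneg_left
      (Finset.sum_le_sum fun y _ => mul_le_mul_of_nonneg_left (add_le_add
        (mul_le_mul_of_nonneg_left (E.χ_le (E.delivers_self M _)) (E.trans_nonneg _ _))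
        (S.trans_mul_le _)) (E.p_nonneg _ _)) E.δ_pos.le)
  have hline : ∀ ν Δ a b : ℝ, (ν, Δ) ∈ interior E.A →
      ∀ᶠ ε : ℝ in 𝓝 0, (ν + a * ε, Δ + b * ε) ∈ E.A := by
    intro ν Δ a b hq
    have hcont : Tendsto (fun ε : ℝ => (ν + a * ε, Δ + b * ε)) (𝓝 0) (𝓝 (ν, Δ)) := by
      have : Continuous (fun ε : ℝ => (ν + a * ε, Δ + b * ε)) := by fun_prop
      simpa using this.tendsto 0
    exact hcont.eventually (mem_interior_iff_mem_nhds.1 hq)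
  have hgline : ∀ φ, ∀ᶠ ε : ℝ in 𝓝 0, 0 < g φ (E.u (c (φ :: s)) + r * ε) ∧
      E.u (g φ (E.u (c (φ :: s)) + r * ε)) = E.u (c (φ :: s)) + r * ε := by
    intro φ
    have hcont : Tendsto (fun ε : ℝ => E.u (c (φ :: s)) + r * ε) (𝓝 0)
        (𝓝 (E.u (c (φ :: s)))) := by
      have : Continuous (fun ε : ℝ => E.u (c (φ :: s)) + r * ε) := by fun_prop
      simpa using this.tendsto 0
    exact hcont.eventually (hge φ)
  have hmin : IsLocalMin K 0 := by
    filter_upwards [hline _ _ A B hA, eventually_all.2 fun φ => hline _ _ a b (hA' φ),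
      eventually_all.2 hgline] with ε h1 h2 h3
    refine hK0.trans (le_of_forall_pos_le_add fun t ht => ?_)
    have hden : 0 < 1 + E.δ * E.trans h h :=
      add_pos one_pos (mul_pos E.δ_pos E.trans_h_h_pos)
    -- The infimum `χ` need not be attained at perturbed points; near-minimizers with this tolerance
    -- have total excess at most `t`.
    have ht' : 0 < t / (1 + E.δ * E.trans h h) := div_pos ht hden
    obtain ⟨z, hz, hzc⟩ := E.exists_cost_lt h1 ht'
    choose z' hz' hzc' using fun φ => E.exists_cost_lt (h2 φ) ht'
    have hcx : ∀ φ, ∃ x : ℝ≥0, (x : ℝ) = g φ (E.u (c (φ :: s)) + r * ε) := fun φ =>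
      ⟨_, Real.coe_toNNReal _ (h3 φ).1.le⟩
    choose c' hc' using hcx
    have hle := S.cost_le (a := a * ε) (b := b * ε) (z := z) (z' := z') (c' := c')
      (by convert hz using 1 <;> simp only [A, B] <;> ring) hz'
      (fun φ => by rw [hc', (h3 φ).2]; simp only [r]; ring)
    refine hle.trans ?_
    have hsum : ∑ y, E.p h y * (E.trans h h * E.cost (z' (E.signal y)) h
          + E.trans h l * (E.annuity n * c' (E.signal y)))
        ≤ ∑ y, E.p h y * (E.trans h h * E.χ (E.flowUtility M (E.signal y :: s) + a * ε)
          (E.distortion M (E.signal y :: s) + b * ε)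
        + E.trans h l * (E.annuity n * g (E.signal y) (E.u (c (E.signal y :: s)) + r * ε)))
        + E.trans h h * (t / (1 + E.δ * E.trans h h)) := by
      have e1 : E.trans h h * (t / (1 + E.δ * E.trans h h))
          = ∑ y, E.p h y * (E.trans h h * (t / (1 + E.δ * E.trans h h))) := by
        rw [← Finset.sum_mul, E.p_sum, one_mul]
      rw [e1, ← Finset.sum_add_distrib]
      refine Finset.sum_le_sum fun y _ => ?_
      rw [← mul_add, hc']
      refine mul_le_mul_of_nonneg_left ?_ (E.p_nonneg _ _)
      have := mul_le_mul_of_nonneg_left (hzc' (E.signal y)).le (E.trans_nonneg h h)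
      linarith
    have hsum' := mul_le_mul_of_nonneg_left hsum E.δ_pos.le
    have ht2 : t / (1 + E.δ * E.trans h h)
        + E.δ * (E.trans h h * (t / (1 + E.δ * E.trans h h))) = t := by
      field_simp
    simp only [K]
    linarith
  refine Eq.trans ?_ (hmin.hasDerivAt_eq_zero hK)
  simp only [A, B, r]
  congr 2
  refine Finset.sum_congr rfl fun y _ => ?_
  field_simp

end

end Setting

/-! ### From incomes to signals, and the two equations -/

theorem sum_pSig_mul [Fintype Φ] (i : RiskType) (f : Φ → ℝ) :
    ∑ φ, E.pSig i φ * f φ = ∑ y, E.p i y * f (E.signal y) := by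
  classical
  simp only [pSig, Finset.sum_mul, ite_mul, zero_mul]
  rw [Finset.sum_comm]
  refine Finset.sum_congr rfl fun y _ => ?_
  convert Finset.sum_ite_eq Finset.univ (E.signal y) fun φ => E.p i y * f φ using 2
  simp

end InsuranceModel

theorem mainTheorem3 {Φ : Type*} [Fintype Φ] (E : InsuranceModel Φ)
    (V : RiskType → ℝ) (hV : V RiskType.l ≤ V RiskType.h)
    (M : E.Mechanism) (hM : E.IsOptimal V M)
    (s : List Φ) (hs : s.length + 1 < E.T)
    (hint : (E.flowUtility M s, E.distortion M s) ∈ interior E.A)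
    (hint' : ∀ φ : Φ, (E.flowUtility M (φ :: s), E.distortion M (φ :: s)) ∈ interior E.A) :
    -- the derivatives below exist
    (E.χDifferentiableAt (E.flowUtility M s) (E.distortion M s) ∧
      (∀ φ : Φ, E.χDifferentiableAt (E.flowUtility M (φ :: s)) (E.distortion M (φ :: s))) ∧
      (0 < E.trans RiskType.h RiskType.l →
        ∀ φ : Φ, E.χDifferentiableAt (E.lowFlowUtility M (φ :: s)) 0)) ∧
    -- intertemporal allocation of flow utility
    E.χν (E.flowUtility M s) (E.distortion M s) =
      ∑ φ : Φ, E.pSig RiskType.h φ *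
        (E.trans RiskType.h RiskType.h *
            E.χν (E.flowUtility M (φ :: s)) (E.distortion M (φ :: s)) +
          E.trans RiskType.h RiskType.l * E.χν (E.lowFlowUtility M (φ :: s)) 0) ∧
    -- intertemporal allocation of distortions
    E.χΔ (E.flowUtility M s) (E.distortion M s) =
      ∑ φ : Φ, E.pSig RiskType.h φ *
        (E.trans RiskType.h RiskType.h /
          (E.trans RiskType.h RiskType.h - E.trans RiskType.l RiskType.h)) *
        (E.χΔ (E.flowUtility M (φ :: s)) (E.distortion M (φ :: s)) +
          E.trans RiskType.h RiskType.l *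
            (E.χν (E.flowUtility M (φ :: s)) (E.distortion M (φ :: s)) -
              E.χν (E.lowFlowUtility M (φ :: s)) 0)) := by
  obtain ⟨c, hc⟩ := E.exists_lowEquiv M
  have S : E.Setting V M c (E.T - s.length - 1) s :=
    ⟨hV, hM, hc, by omega, by omega⟩
  have hd := E.χDifferentiableAt_of_mem_interior (E.delivers_self M s)
    (S.cost_le_χ (interior_subset hint)) hint
  have hd' := fun φ => E.χDifferentiableAt_of_mem_interior (E.delivers_self M (φ :: s))
    (S.cost_le_χ_cons φ (interior_subset (hint' φ))) (hint' φ)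
  have hlow : ∀ φ, E.trans RiskType.h RiskType.l * E.χν (E.u (c (φ :: s))) 0
      = E.trans RiskType.h RiskType.l * E.χν (E.lowFlowUtility M (φ :: s)) 0 := by
    intro φ
    obtain h0 | h0 := (E.trans_nonneg RiskType.h RiskType.l).eq_or_lt
    · rw [← h0, zero_mul, zero_mul]
    · rw [S.lowFlowUtility_eq h0]
  refine ⟨⟨hd, hd', fun h0 φ => ?_⟩, ?_⟩
  · rw [S.lowFlowUtility_eq h0]
    exact E.χDifferentiableAt_const (S.low_pos φ (hint' φ))
  have e1 : E.trans RiskType.h RiskType.h = 1 - E.trans RiskType.h RiskType.l := by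
    linarith [E.trans_add RiskType.h]
  have e2 : E.trans RiskType.l RiskType.h = 1 - E.trans RiskType.l RiskType.l := by
    linarith [E.trans_add RiskType.l]
  have hκ : 0 < E.trans RiskType.l RiskType.l - E.trans RiskType.h RiskType.l :=
    sub_pos.2 E.trans_h_l_lt
  have hν : E.χν (E.flowUtility M s) (E.distortion M s) =
      ∑ φ : Φ, E.pSig RiskType.h φ *
        (E.trans RiskType.h RiskType.h *
            E.χν (E.flowUtility M (φ :: s)) (E.distortion M (φ :: s)) +
          E.trans RiskType.h RiskType.l * E.χν (E.lowFlowUtility M (φ :: s)) 0) := by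
    have h1 := S.first_order hint hint' hd hd' 1 0
    simp only [mul_zero, sub_zero, mul_one, one_mul, zero_mul, add_zero, neg_zero, hlow] at h1
    rw [E.sum_pSig_mul]
    exact mul_left_cancel₀ E.δ_pos.ne' (by linarith)
  refine ⟨hν, ?_⟩
  have h1 := S.first_order hint hint' hd hd' 0 1
  simp only [mul_one, one_mul, zero_mul, zero_add, zero_sub, neg_mul, mul_neg, neg_neg, hlow] at h1
  have hκ' : E.trans RiskType.h RiskType.h - E.trans RiskType.l RiskType.h
      = E.trans RiskType.l RiskType.l - E.trans RiskType.h RiskType.l := by rw [e1, e2]; ring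
  simp only [mul_assoc]
  rw [E.sum_pSig_mul RiskType.h] at hν ⊢
  -- Direction (0, 1) still contains today's marginal cost of utility. Replacing it by `hν` and
  -- using `trans h h = 1 - trans h l` brings out the factor `trans h h`.
  have h2 : (E.trans RiskType.l RiskType.l - E.trans RiskType.h RiskType.l) *
        E.χΔ (E.flowUtility M s) (E.distortion M s)
      = E.trans RiskType.h RiskType.l * E.χν (E.flowUtility M s) (E.distortion M s)
        + ∑ y, E.p RiskType.h y * (E.trans RiskType.h RiskType.h *
          E.χΔ (E.flowUtility M (E.signal y :: s)) (E.distortion M (E.signal y :: s))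
          + -(E.trans RiskType.h RiskType.l *
            E.χν (E.lowFlowUtility M (E.signal y :: s)) 0)) :=
    mul_left_cancel₀ E.δ_pos.ne' (by linarith)
  rw [← mul_right_inj' hκ.ne', h2, hν, Finset.mul_sum, ← Finset.sum_add_distrib, Finset.mul_sum,
    hκ']
  refine Finset.sum_congr rfl fun y _ => ?_
  field_simp
  rw [e1]
  ring
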